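/- **Model and oracle.** Let $\mathbf X\in\mathbb R^d$ have law $\mathbb P_{\mathbf X}$ and $Y=f^*(\mathbf X)+\sigma(\mathbf X)\varepsilon$ with $\varepsilon\sim\mathcal N(0,1)$ independent of $\mathbf X$; let $p(\cdot|\mathbf x)$ be the density of $\mathcal N(f^*(\mathbf x),\sigma^2(\mathbf x))$. For $\ell>0$ put $G(t)=\int_{\mathbb R}\mathbb P_{\mathbf X}(p(y|\mathbf X)\ge t)\,dy$, $\lambda^*_\ell=G^{-1}(\ell)$, $\Gamma^*_\ell(\mathbf x)=\{y: p(y|\mathbf x)\ge\lambda^*_\ell\}$, where for nonincreasing $H$ on $[0,\infty)$, $H^{-1}(a)=\inf\{t\ge 0: H(t)\le a\}$. For a predictor $\Gamma$ (a map from $\mathbb R^d$, or from $\mathbb R^d\times[0,u]$ if randomized by an independent $\zeta$, to subsets of $\mathbb R$) let $R_\ell(\Gamma)=\mathbb P(Y\notin\Gamma)+\lambda^*_\ell\,\mathbb E[\mathrm{Leb}(\Gamma)]$ and $\mathcal E_\ell(\Gamma)=R_\ell(\Gamma)-R_\ell(\Gamma^*_\ell)$. **Data-driven predictor.** Let $\mathcal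 D_n=\{(\mathbf X_i,Y_i)\}_{i\le n}$ be i.i.d. copies of $(\mathbf X,Y)$, $\mathbf X_{n+1},\dots,\mathbf X_{n+N}$ i.i.d. copies of $\mathbf X$, and $\zeta,\zeta_1,\dots,\zeta_N$ i.i.d. uniform on $[0,u]$, $u>0$, all independent and independent of $(\mathbf X,Y)$. Let $\hat f,\tilde\sigma^2$ be arbitrary (jointly measurable) real-valued estimators built from $\mathcal D_n$. For $s>0$ let $\hat\sigma^2=\tilde\sigma^2\mathbf 1_{\{s^{-1}\le\tilde\sigma^2\le s\}}+s^{-1}\mathbf 1_{\{\tilde\sigma^2<s^{-1}\}}+s\mathbf 1_{\{\tilde\sigma^2>s\}}$, let $\hat p(y|\mathbf x)$ be the density of $\mathcal N(\hat f(\mathbf x),\hat\sigma^2(\mathbf x))$ at $y$ times $\mathbf 1_{\{|y|\le s\}}$, and $\hat p(y|\mathbf x,z)=\hat p(y|\mathbf x)+z\mathbf 1_{\{|y|\le s\}}$. With $y_k=-s+2s(k-1)/M$, $k=1,\dots,M$, put $$\hat G(t)=\frac{2s}{MN}\sum_{k=1}^M\sum_{i=1}^N\mathbf 1_{\{\hat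 p(y_k|\mathbf X_{n+i},\zeta_i)>t\}},\qquad \hat\Gamma(\mathbf x,z)=\{y\in\mathbb R:\hat p(y|\mathbf x,z)\ge\hat G^{-1}(\ell)\}.$$ **Assumptions.** (i) There are $0<\sigma_0<\sigma_1<\infty$ with $\sigma_0\le\sigma(\mathbf x)\le\sigma_1$ for all $\mathbf x\in\mathbb R^d$. (ii) $f^*$ and $\sigma^2$ are Lipschitz. (iii) $\mathbb P_{\mathbf X}$ is supported on a compact regular set $\mathcal C$ (there are $c,r_0>0$ with $\mathrm{Leb}(\mathcal C\cap B(\mathbf x,r))\ge c\,\mathrm{Leb}(B(\mathbf x,r))$ for all $\mathbf x\in\mathcal C$, $0<r\le r_0$) and has a Lebesgue density $\mu$ with $0<\mu_{\min}\le\mu\le\mu_{\max}<\infty$ on $\mathcal C$. (iv) Margin condition with $\alpha\ge 0$, $c_0,t_0>0$: $\int_{\mathbb R}\mathbb P_{\mathbf X}(|p(y|\mathbf X)-\lambda^*_\ell|\le t)\,dy\le c_0t^\alpha$ for all $0<t\le t_0$. **Statement.** There is a constant $C>0$, depending only on $d$, $f^*$, $\sigma^2$, $\mathcal C$, $c_0$,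 $t_0$ and $\alpha$, such that under (i)–(iv), for $s=\log(\min(n,N))$, every $M>4\sqrt N$, every $u>0$ and every $\ell>0$ with $\ell<2s$, $$\mathbb E[\mathcal E_\ell(\hat\Gamma)]\le C\left(\mathbb E\Big[\Big(\sup_{(\mathbf x,y)\in\mathcal C\times[-s,s]}|\hat p(y|\mathbf x)-p(y|\mathbf x)|\Big)^{1+\alpha}\Big]+\frac1{\min(n,N)^{1+\alpha}}+u^{1+\alpha}+\frac{\log N}{\sqrt N}\right).$$ -/

import Mathlib

open MeasureTheory ProbabilityTheory
open scoped ENNReal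

noncomputable section

namespace LengthPI

/-- The feature space `ℝ^d` with its Euclidean structure. -/
abbrev Feat (d : ℕ) : Type := EuclideanSpace ℝ (Fin d)

variable {d : ℕ}

/-! ### The heteroscedastic Gaussian model and the oracle -/

/-- The law of `(X, Y)` with `X ∼ PX`, `Y = f(X) + σ(X) ε`, where `ε ∼ N(0,1)` is independent
of `X`. -/
def jointLaw (PX : Measure (Feat d)) (f σ : Feat d → ℝ) : Measure (Feat d × ℝ) :=
  (PX.prod (gaussianReal 0 1)).map (fun w => (w.1, f w.1 + σ w.1 * w.2))

/-- The conditional density `p(y|x)` of `Y` given `X = x`: the density of `N(f(x), σ(x)^2)`. -/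
def condDens (f σ : Feat d → ℝ) (x : Feat d) (y : ℝ) : ℝ :=
  gaussianPDFReal (f x) (σ x ^ 2).toNNReal y

/-- Generalized inverse of a nonincreasing function on `[0, ∞)`:
`G⁻¹(a) = inf {t ≥ 0 : G(t) ≤ a}`. -/
def genInv (G : ℝ → ℝ≥0∞) (a : ℝ) : ℝ :=
  sInf {t : ℝ | 0 ≤ t ∧ G t ≤ ENNReal.ofReal a}

/-- `G(t) = ∫ P(p(y|X) ≥ t) dy`. -/
def lengthFun (PX : Measure (Feat d)) (f σ : Feat d → ℝ) (t : ℝ) : ℝ≥0∞ :=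
  ∫⁻ y : ℝ, PX {x | t ≤ condDens f σ x y}

/-- The oracle threshold `λ*_ℓ = G⁻¹(ℓ)`. -/
def oracleLevel (PX : Measure (Feat d)) (f σ : Feat d → ℝ) (l : ℝ) : ℝ :=
  genInv (lengthFun PX f σ) l

/-- The oracle predictor `Γ*_ℓ(x) = {y : p(y|x) ≥ λ*_ℓ}`. -/
def oraclePredictor (PX : Measure (Feat d)) (f σ : Feat d → ℝ) (l : ℝ) (x : Feat d) : Set ℝ :=
  {y | oracleLevel PX f σ l ≤ condDens f σ x y}

/-! ### Risk of a (randomized) predictor -/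

/-- `R_ℓ(Γ) = P(Y ∉ Γ(X, ζ)) + λ*_ℓ E[Leb(Γ(X, ζ))]` for a predictor `Γ` that may use an
external randomization `ζ ∼ ν` independent of `(X, Y)`. -/
def risk (PX : Measure (Feat d)) (f σ : Feat d → ℝ) (l : ℝ) (ν : Measure ℝ)
    (Γ : Feat d → ℝ → Set ℝ) : ℝ≥0∞ :=
  ((jointLaw PX f σ).prod ν) {w | w.1.2 ∉ Γ w.1.1 w.2}
    + ENNReal.ofReal (oracleLevel PX f σ l) * ∫⁻ w, volume (Γ w.1 w.2) ∂(PX.prod ν)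

/-- The excess risk `R_ℓ(Γ) - R_ℓ(Γ*_ℓ)`, with values in `[0, ∞]`.  The oracle has finite risk
(and minimal risk); the truncation of the subtraction at `0` can only make an upper bound on the
excess risk stronger. -/
def excessRisk (PX : Measure (Feat d)) (f σ : Feat d → ℝ) (l : ℝ) (ν : Measure ℝ)
    (Γ : Feat d → ℝ → Set ℝ) : ℝ≥0∞ :=
  risk PX f σ l ν Γ - risk PX f σ l ν (fun x _ => oraclePredictor PX f σ l x)

/-! ### The data-driven predictor -/

/-- Thresholded variance: `v` if `1/s ≤ v ≤ s`, plus `1/s` if `v < 1/s`, plus `s` if `v > s`. -/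
def threshVar (s v : ℝ) : ℝ :=
  (if s⁻¹ ≤ v ∧ v ≤ s then v else 0) + (if v < s⁻¹ then s⁻¹ else 0) + (if s < v then s else 0)

/-- The estimated density `p̂(y|x)`: the Gaussian density with mean `g(x)` and thresholded variance
computed from `v(x)`, set to zero outside `[-s, s]`. -/
def estDens (s : ℝ) (g v : Feat d → ℝ) (x : Feat d) (y : ℝ) : ℝ :=
  if |y| ≤ s then gaussianPDFReal (g x) (threshVar s (v x)).toNNReal y else 0

/-- The randomized estimate `p̂(y|x, z) = p̂(y|x) + z 1{|y| ≤ s}`. -/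
def estDensRand (s : ℝ) (g v : Feat d → ℝ) (x : Feat d) (z y : ℝ) : ℝ :=
  estDens s g v x y + (if |y| ≤ s then z else 0)

/-- The `k`-th point (`k = 0, …, M-1`) of the regular grid of `[-s, s]` with mesh `2s/M`. -/
def gridPt (s : ℝ) (M k : ℕ) : ℝ := -s + 2 * s * k / M

/-- The empirical, discretized length function
`Ĝ(t) = (2s / (M N)) ∑_k ∑_i 1{p̂(y_k | X_{n+i}, ζ_i) > t}`. -/
def empLengthFun (s : ℝ) (M : ℕ) {N : ℕ} (g v : Feat d → ℝ) (xs : Fin N → Feat d)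
    (zs : Fin N → ℝ) (t : ℝ) : ℝ :=
  2 * s / (M * N) * ∑ k ∈ Finset.range M, ∑ i : Fin N,
    if t < estDensRand s g v (xs i) (zs i) (gridPt s M k) then (1 : ℝ) else 0

/-- The data-driven predictor `Γ̂(x, z) = {y : p̂(y|x, z) ≥ Ĝ⁻¹(ℓ)}`. -/
def empPredictor (s : ℝ) (M : ℕ) {N : ℕ} (g v : Feat d → ℝ) (xs : Fin N → Feat d)
    (zs : Fin N → ℝ) (l : ℝ) (x : Feat d) (z : ℝ) : Set ℝ :=
  {y | genInv (fun t => ENNReal.ofReal (empLengthFun s M g v xs zs t)) l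
        ≤ estDensRand s g v x z y}

/-- The uniform distribution on `[0, u]`. -/
def unif (u : ℝ) : Measure ℝ := ProbabilityTheory.cond volume (Set.Icc 0 u)

/-- The law of the labeled sample: `n` i.i.d. copies of `(X, Y)`. -/
def labeledLaw (PX : Measure (Feat d)) (f σ : Feat d → ℝ) (n : ℕ) :
    Measure (Fin n → Feat d × ℝ) :=
  Measure.pi (fun _ => jointLaw PX f σ)

/-- The joint law of the labeled sample, of the unlabeled sample (`N` i.i.d. copies of `X`) and of
the `N` i.i.d. uniform perturbations, all independent. -/
def sampleLaw (PX : Measure (Feat d)) (f σ : Feat d → ℝ) (n N : ℕ) (u : ℝ) :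
    Measure ((Fin n → Feat d × ℝ) × (Fin N → Feat d) × (Fin N → ℝ)) :=
  (labeledLaw PX f σ n).prod
    ((Measure.pi (fun _ : Fin N => PX)).prod (Measure.pi (fun _ : Fin N => unif u)))

/-! ### Assumptions -/

/-- Bounded variance. -/
def BoundedSigma (σ : Feat d → ℝ) : Prop :=
  ∃ σ₀ σ₁ : ℝ, 0 < σ₀ ∧ σ₀ < σ₁ ∧ ∀ x, σ₀ ≤ σ x ∧ σ x ≤ σ₁

/-- A regular set: there are `c, r₀ > 0` with `Leb(K ∩ B(x, r)) ≥ c Leb(B(x, r))` for all `x ∈ K`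
and `0 < r ≤ r₀`. -/
def IsRegularSet (K : Set (Feat d)) : Prop :=
  ∃ c r₀ : ℝ, 0 < c ∧ 0 < r₀ ∧ ∀ x ∈ K, ∀ r : ℝ, 0 < r → r ≤ r₀ →
    ENNReal.ofReal c * volume (Metric.closedBall x r) ≤ volume (K ∩ Metric.closedBall x r)

/-- Strong density assumption: `PX` is supported on the compact regular set `K` and has a Lebesgue
density bounded away from zero and infinity on `K`. -/
def StrongDensity (PX : Measure (Feat d)) (K : Set (Feat d)) : Prop :=
  IsCompact K ∧ IsRegularSet K ∧ PX Kᶜ = 0 ∧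
    ∃ μ : Feat d → ℝ, Measurable μ ∧ PX = volume.withDensity (fun x => ENNReal.ofReal (μ x)) ∧
      ∃ μmin μmax : ℝ, 0 < μmin ∧ ∀ x ∈ K, μmin ≤ μ x ∧ μ x ≤ μmax

/-- Margin assumption with parameter `α` at the given level, with constants `c₀` and `t₀`. -/
def MarginCondition (PX : Measure (Feat d)) (f σ : Feat d → ℝ) (level c₀ t₀ α : ℝ) : Prop :=
  ∀ t : ℝ, 0 < t → t ≤ t₀ →
    ∫⁻ y : ℝ, PX {x | |condDens f σ x y - level| ≤ t} ≤ ENNReal.ofReal (c₀ * t ^ α)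

/-- `sup_{(x, y) ∈ K × [-s, s]} |p̂(y|x) - p(y|x)|`, with values in `[0, ∞]`. -/
def supError (K : Set (Feat d)) (f σ : Feat d → ℝ) (s : ℝ) (g v : Feat d → ℝ) : ℝ≥0∞ :=
  ⨆ x ∈ K, ⨆ y ∈ Set.Icc (-s) s, ENNReal.ofReal |estDens s g v x y - condDens f σ x y|

end LengthPI

end

/-! Work on triples `((x, z), y)` with the reference measure `PX ⊗ ν ⊗ Leb`. Let `p` be the
conditional density, `q` the perturbed estimate, `S` the slab `|y| ≤ s`, and `λ` the oracle level. A
predictor whose graph `A` has finite measure has risk `1 - ∫_A (p - λ)` (`risk_eq_ofReal`), so an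
excess risk is a difference of two such integrals.

Between the oracle set `{λ ≤ p}` and the empirical set, insert `{kap ≤ q} ∩ S`, with `kap` chosen so
that its measure is exactly `l`. Such a level exists because Gaussian level sets are null, so the
expected length `estLength` is continuous in the level, and it falls from `2s > l` to `0`. The
oracle set also has measure exactly `l` (`genInv_superlevel`).

Oracle against intermediate set (`plugin_threshold_le`): the measures agree, so `λ` cancels and only
`p` on the two set differences remains. There `q` is within `ε` of `p` on `S`, and the margin
condition bounds the measure of the relevant points by `c₀ ε^α`. This yields order `ε^(1+α)` with `ε
= Δ + u`, plus the mass of `p` outside `S`. A Chernoff bound with parameter `1 + α` at `s = log (min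
n N)` makes that mass of order `(min n N)^(-(1+α))`.

Intermediate against empirical set (`threshold_level_change_le`): both are superlevel sets of `q` on
`S`, hence nested, so the cost is at most `sup p` times the difference of their lengths.

The mean length error is controlled without any uniform bound
(`lintegral_empirical_quantile_error_le`): by monotonicity, a large error at the random level forces
the empirical length to deviate at one deterministic level. Chebyshev there gives a quadratic tail,
which integrates to order `s / √N`. The grid adds a bias of at most one mesh `2s / M`, because
Gaussian superlevel sets are intervals (`abs_grid_sum_sub_volume_le`). -/

namespace LengthPI

/-! ### Deterministic comparison of threshold sets. -/

section Threshold

variable {Ω : Type*} [MeasurableSpace Ω] {m : Measure Ω} {p q : Ω → ℝ} {S : Set Ω}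

/-- For two sets of equal finite measure, the difference of the integrals of `p - lam` is the
difference of the integrals of `p` over the two set differences. -/
lemma setIntegral_sub_const_diff {A B : Set Ω} (hA : MeasurableSet A) (hB : MeasurableSet B)
    (hp : Integrable p m) (hfA : m A ≠ ∞) (hfB : m B ≠ ∞) (lam : ℝ) :
    (∫ w in A, (p w - lam) ∂m) - ∫ w in B, (p w - lam) ∂m
      = (∫ w in A \ B, p w ∂m) - (∫ w in B \ A, p w ∂m)
        - lam * (m.real (A \ B) - m.real (B \ A)) := by
  have e : ∀ C : Set Ω, m C ≠ ∞ → ∫ w in C, (p w - lam) ∂m = (∫ w in C, p w ∂m) - lam * m.real C := by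
    intro C hC
    rw [integral_sub hp.integrableOn (integrableOn_const hC)]
    simp [mul_comm]
  have h1 := integral_inter_add_sdiff (s := A) hB (hp.integrableOn (s := A))
  have h2 := integral_inter_add_sdiff (s := B) hA (hp.integrableOn (s := B))
  have h3 := measureReal_inter_add_sdiff (μ := m) (s := A) hB hfA
  have h4 := measureReal_inter_add_sdiff (μ := m) (s := B) hA hfB
  rw [Set.inter_comm] at h2 h4
  rw [e A hfA, e B hfB, ← h1, ← h2, ← h3, ← h4]
  ring

lemma setIntegral_le_of_le {C : Set Ω} (hC : MeasurableSet C) (hp : Integrable p m)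
    (hf : m C ≠ ∞) {b : ℝ} (h : ∀ᵐ w ∂m, w ∈ C → p w ≤ b) : ∫ w in C, p w ∂m ≤ b * m.real C := by
  calc ∫ w in C, p w ∂m ≤ ∫ w in C, b ∂m :=
        setIntegral_mono_on_ae hp.integrableOn (integrableOn_const hf) hC h
    _ = b * m.real C := by simp [mul_comm]

lemma le_setIntegral_of_le {C : Set Ω} (hC : MeasurableSet C) (hp : Integrable p m)
    (hf : m C ≠ ∞) {b : ℝ} (h : ∀ᵐ w ∂m, w ∈ C → b ≤ p w) : b * m.real C ≤ ∫ w in C, p w ∂m := by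
  calc b * m.real C = ∫ w in C, b ∂m := by simp [mul_comm]
    _ ≤ ∫ w in C, p w ∂m :=
        setIntegral_mono_on_ae (integrableOn_const hf) hp.integrableOn hC h

lemma measureReal_le_of_ae_imp {C D : Set Ω} {c : ℝ} (hc : 0 ≤ c)
    (h : ∀ᵐ w ∂m, w ∈ C → w ∈ D) (hD : m D ≤ ENNReal.ofReal c) : m.real C ≤ c :=
  ENNReal.toReal_le_of_le_ofReal hc ((measure_mono_ae h).trans hD)

/-- Excess risk of a plug-in threshold set `{kap ≤ q} ∩ S` having the same measure as the oracle
set `{lam ≤ p}`, when `q` is `ε`-close to `p` on `S`. -/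
lemma plugin_threshold_le (hpm : Measurable p) (hqm : Measurable q) (hS : MeasurableSet S)
    (hp : Integrable p m) (hp0 : ∀ w, 0 ≤ p w) {lam kap ε c : ℝ} (hlam : 0 ≤ lam) (hkap : 0 ≤ kap)
    (hε : 0 ≤ ε) (hc : 0 ≤ c)
    (hfA : m {w | lam ≤ p w} ≠ ∞)
    (heq : m ({w | kap ≤ q w} ∩ S) = m {w | lam ≤ p w})
    (hclose : ∀ᵐ w ∂m, w ∈ S → |q w - p w| ≤ ε)
    (hmargin : m {w | |p w - lam| ≤ ε} ≤ ENNReal.ofReal c) :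
    (∫ w in {w | lam ≤ p w}, (p w - lam) ∂m) - ∫ w in {w | kap ≤ q w} ∩ S, (p w - lam) ∂m
      ≤ 2 * ε * c + 2 * ∫ w in Sᶜ, p w ∂m := by
  set A := {w | lam ≤ p w} with hAdef
  set B := {w | kap ≤ q w} ∩ S with hBdef
  have hA : MeasurableSet A := measurableSet_le measurable_const hpm
  have hB : MeasurableSet B := (measurableSet_le measurable_const hqm).inter hS
  have hfB : m B ≠ ∞ := heq ▸ hfA
  rw [setIntegral_sub_const_diff hA hB hp hfA hfB lam]
  have hfAB : m (A \ B) ≠ ∞ := measure_ne_top_of_subset Set.sdiff_subset hfA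
  have hfBA : m (B \ A) ≠ ∞ := measure_ne_top_of_subset Set.sdiff_subset hfB
  have hmeq : m.real (A \ B) = m.real (B \ A) := by
    have h3 := measureReal_inter_add_sdiff (μ := m) (s := A) hB hfA
    have h4 := measureReal_inter_add_sdiff (μ := m) (s := B) hA hfB
    have h5 : m.real A = m.real B := by simp [Measure.real, heq]
    rw [Set.inter_comm] at h4
    linarith
  have hsplit := integral_inter_add_sdiff (s := A \ B) hS (hp.integrableOn (s := A \ B))
  have hsplit' := measureReal_inter_add_sdiff (μ := m) (s := A \ B) hS hfAB
  -- `A \ B` is split along `S`: closeness of `q` to `p` controls the part inside, and only the tail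
  -- mass of `p` controls the part outside.
  set a := m.real (A \ B ∩ S)
  set o := m.real ((A \ B) \ S)
  set b := m.real (B \ A)
  have hfa : m (A \ B ∩ S) ≠ ∞ := measure_ne_top_of_subset Set.inter_subset_left hfAB
  have hfo : m ((A \ B) \ S) ≠ ∞ := measure_ne_top_of_subset Set.sdiff_subset hfAB
  have ha0 : 0 ≤ a := measureReal_nonneg
  have ho0 : 0 ≤ o := measureReal_nonneg
  have hmA := (hA.diff hB).inter hS
  have hmO := (hA.diff hB).diff hS
  have I1 : ∫ w in A \ B ∩ S, p w ∂m ≤ (kap + ε) * a := by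
    refine setIntegral_le_of_le hmA hp hfa ?_
    filter_upwards [hclose] with w hw hwm
    have : ¬ kap ≤ q w := fun h => hwm.1.2 ⟨h, hwm.2⟩
    have := abs_le.1 (hw hwm.2)
    linarith
  have I2 : lam * o ≤ ∫ w in (A \ B) \ S, p w ∂m :=
    le_setIntegral_of_le hmO hp hfo (ae_of_all _ fun w hw => hw.1.1)
  have I3 : ∫ w in (A \ B) \ S, p w ∂m ≤ ∫ w in Sᶜ, p w ∂m :=
    setIntegral_mono_set hp.integrableOn (ae_of_all _ hp0)
      (Filter.Eventually.of_forall fun w hw => hw.2)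
  have I4 : (kap - ε) * b ≤ ∫ w in B \ A, p w ∂m := by
    refine le_setIntegral_of_le (hB.diff hA) hp hfBA ?_
    filter_upwards [hclose] with w hw hwm
    have := hwm.1.1
    have := abs_le.1 (hw hwm.1.2)
    simp only [Set.mem_ofPred_eq] at *
    linarith
  -- On `B \ A`, `p` lies below `lam` and above `kap - ε`. Either alternative gives `p ≥ lam - ε`,
  -- the second one from `p ≥ 0`.
  have hbc : (lam < kap ∨ lam < ε) → b ≤ c := by
    intro h
    refine measureReal_le_of_ae_imp hc ?_ hmargin
    filter_upwards [hclose] with w hw hwm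
    have h1 : kap ≤ q w := hwm.1.1
    have h2 := abs_le.1 (hw hwm.1.2)
    have h3 : p w < lam := not_le.1 hwm.2
    have := hp0 w
    change |p w - lam| ≤ ε
    rw [abs_le]
    rcases h with h | h <;> constructor <;> linarith
  have hac : kap ≤ lam → a ≤ c := by
    intro h
    refine measureReal_le_of_ae_imp hc ?_ hmargin
    filter_upwards [hclose] with w hw hwm
    have h1 : q w < kap := not_le.1 fun h => hwm.1.2 ⟨h, hwm.2⟩
    have h2 := abs_le.1 (hw hwm.2)
    have h3 : lam ≤ p w := hwm.1.1
    change |p w - lam| ≤ ε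
    rw [abs_le]
    constructor <;> linarith
  rw [← hsplit, hmeq, sub_self, mul_zero, sub_zero]
  have hb : b = a + o := by rw [← hmeq, ← hsplit']
  -- With `b = a + o`, the estimates bound the difference by `ε (a + b) - kap * o` plus the tail. If
  -- `b ≤ c`, then `a ≤ c` too. Otherwise `ε ≤ lam` and `a ≤ c`, and the surplus `ε * o ≤ lam * o`
  -- is paid by a second copy of the tail.
  rcases lt_or_ge lam kap with h | h
  · have := hbc (Or.inl h)
    nlinarith
  · have h1 := hac h
    rcases lt_or_ge lam ε with h2 | h2
    · have := hbc (Or.inr h2)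
      nlinarith
    · nlinarith

/-- Crude bound: two sets of equal finite measure differ in excess risk by at most `∫ p`. -/
lemma plugin_threshold_le_integral {A B : Set Ω} (hA : MeasurableSet A) (hB : MeasurableSet B)
    (hp : Integrable p m) (hp0 : ∀ w, 0 ≤ p w) (lam : ℝ) (hfA : m A ≠ ∞) (heq : m B = m A) :
    (∫ w in A, (p w - lam) ∂m) - ∫ w in B, (p w - lam) ∂m ≤ ∫ w, p w ∂m := by
  have hfB : m B ≠ ∞ := heq ▸ hfA
  rw [setIntegral_sub_const_diff hA hB hp hfA hfB lam]
  have h3 := measureReal_inter_add_sdiff (μ := m) (s := A) hB hfA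
  have h4 := measureReal_inter_add_sdiff (μ := m) (s := B) hA hfB
  have h5 : m.real A = m.real B := by simp [Measure.real, heq]
  rw [Set.inter_comm] at h4
  have h6 : m.real (A \ B) - m.real (B \ A) = 0 := by linarith
  have h7 : 0 ≤ ∫ w in B \ A, p w ∂m := integral_nonneg hp0
  have h8 : ∫ w in A \ B, p w ∂m ≤ ∫ w, p w ∂m :=
    setIntegral_le_integral hp (ae_of_all _ hp0)
  rw [h6]
  linarith

/-- Moving the level of a threshold set changes the risk at most proportionally to the change of
its measure. -/
lemma threshold_level_change_le (hqm : Measurable q) (hS : MeasurableSet S)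
    (hp : Integrable p m) (hp0 : ∀ w, 0 ≤ p w) {lam P : ℝ} (hlam : 0 ≤ lam) (hlamP : lam ≤ P)
    (hpP : ∀ w, p w ≤ P) (hfS : m S ≠ ∞) (kap kap' : ℝ) :
    (∫ w in {w | kap ≤ q w} ∩ S, (p w - lam) ∂m) - ∫ w in {w | kap' ≤ q w} ∩ S, (p w - lam) ∂m
      ≤ P * |m.real ({w | kap' ≤ q w} ∩ S) - m.real ({w | kap ≤ q w} ∩ S)| := by
  have hm : ∀ k, MeasurableSet ({w | k ≤ q w} ∩ S) := fun k =>
    (measurableSet_le measurable_const hqm).inter hS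
  have hf : ∀ k, m ({w | k ≤ q w} ∩ S) ≠ ∞ := fun k =>
    measure_ne_top_of_subset Set.inter_subset_right hfS
  have hsub : ∀ k k', k ≤ k' → {w | k' ≤ q w} ∩ S ⊆ {w | k ≤ q w} ∩ S := fun k k' h w hw =>
    ⟨h.trans hw.1, hw.2⟩
  rw [setIntegral_sub_const_diff (hm _) (hm _) hp (hf _) (hf _) lam]
  rcases le_total kap kap' with h | h
  · have h1 := measureReal_sdiff_add_inter (μ := m) (s := {w | kap ≤ q w} ∩ S) (hm kap') (hf _)
    rw [Set.inter_eq_self_of_subset_right (hsub _ _ h)] at h1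
    rw [Set.sdiff_eq_empty.2 (hsub _ _ h)]
    set D := ({w | kap ≤ q w} ∩ S) \ ({w | kap' ≤ q w} ∩ S)
    have h2 : ∫ w in D, p w ∂m ≤ P * m.real D :=
      setIntegral_le_of_le ((hm _).diff (hm _)) hp
        (measure_ne_top_of_subset Set.sdiff_subset (hf _)) (ae_of_all _ fun w _ => hpP w)
    have h3 : 0 ≤ lam * m.real D := mul_nonneg hlam measureReal_nonneg
    have h4 : m.real D ≤ |m.real ({w | kap' ≤ q w} ∩ S) - m.real ({w | kap ≤ q w} ∩ S)| := by
      rw [abs_sub_comm]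
      exact le_trans (by linarith) (le_abs_self _)
    have := mul_le_mul_of_nonneg_left h4 (hlam.trans hlamP)
    simp only [Measure.restrict_empty, integral_zero_measure, measureReal_empty]
    linarith
  · have h1 := measureReal_sdiff_add_inter (μ := m) (s := {w | kap' ≤ q w} ∩ S) (hm kap) (hf _)
    rw [Set.inter_eq_self_of_subset_right (hsub _ _ h)] at h1
    rw [Set.sdiff_eq_empty.2 (hsub _ _ h)]
    set D := ({w | kap' ≤ q w} ∩ S) \ ({w | kap ≤ q w} ∩ S)
    have h2 : 0 ≤ ∫ w in D, p w ∂m := integral_nonneg hp0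
    have h3 : lam * m.real D ≤ P * m.real D := mul_le_mul_of_nonneg_right hlamP measureReal_nonneg
    have h4 : m.real D ≤ |m.real ({w | kap' ≤ q w} ∩ S) - m.real ({w | kap ≤ q w} ∩ S)| :=
      le_trans (by linarith) (le_abs_self _)
    have := mul_le_mul_of_nonneg_left h4 (hlam.trans hlamP)
    simp only [Measure.restrict_empty, integral_zero_measure, measureReal_empty]
    linarith

end Threshold

/-! ### Deviation of empirical means and of empirical quantiles. -/

section Sampling

/-- Chebyshev's inequality for the empirical mean of a bounded function of i.i.d. pairs. -/
lemma meas_empirical_mean_deviation_le {α β : Type*} [MeasurableSpace α] [MeasurableSpace β]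
    (P : Measure α) (ν : Measure β) [IsProbabilityMeasure P] [IsProbabilityMeasure ν] {N : ℕ}
    (hN : 0 < N) {φ : α × β → ℝ} (hφ : Measurable φ) {b : ℝ} (hb : ∀ z, φ z ∈ Set.Icc 0 b)
    {δ : ℝ} (hδ : 0 < δ) :
    ((Measure.pi fun _ : Fin N => P).prod (Measure.pi fun _ : Fin N => ν))
        {w | δ ≤ |(N : ℝ)⁻¹ * (∑ i, φ (w.1 i, w.2 i)) - ∫ z, φ z ∂(P.prod ν)|}
      ≤ ENNReal.ofReal ((b / 2) ^ 2 / N / δ ^ 2) := by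
  have hmem : MemLp φ 2 (P.prod ν) :=
    memLp_of_bounded (ae_of_all _ hb) hφ.aestronglyMeasurable 2
  set Q := Measure.pi fun _ : Fin N => P.prod ν with hQ
  set A : (Fin N → α × β) → ℝ := fun z => (N : ℝ)⁻¹ * ∑ i, φ (z i) with hA
  have hNR : (0 : ℝ) < N := Nat.cast_pos.2 hN
  have hint : ∀ i : Fin N, Integrable (fun z : Fin N → α × β => φ (z i)) Q := fun i =>
    (measurePreserving_eval (fun _ : Fin N => P.prod ν) i).integrable_comp_of_integrable
      (hmem.integrable (by norm_num))
  have hmean : ∫ z, A z ∂Q = ∫ z, φ z ∂(P.prod ν) := by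
    simp only [hA]
    rw [integral_const_mul, integral_finsetSum _ fun i _ => hint i]
    have : ∀ i : Fin N, ∫ z, φ (z i) ∂Q = ∫ z, φ z ∂(P.prod ν) := by
      intro i
      have h := (measurePreserving_eval (fun _ : Fin N => P.prod ν) i)
      rw [← h.map_eq, integral_map h.measurable.aemeasurable hφ.aestronglyMeasurable]
    simp only [this, Finset.sum_const, Finset.card_univ, Fintype.card_fin, nsmul_eq_mul]
    field_simp
  have hvar : Var[A; Q] ≤ (b / 2) ^ 2 / N := by
    have h1 : Var[∑ i, fun z : Fin N → α × β => φ (z i); Q] = ∑ _i : Fin N, Var[φ; P.prod ν] :=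
      variance_sum_pi (X := fun _ => φ) fun _ => hmem
    have h2 : Var[φ; P.prod ν] ≤ ((b - 0) / 2) ^ 2 :=
      variance_le_sq_of_bounded (ae_of_all _ hb) hφ.aemeasurable
    have h3 : A = fun z => (N : ℝ)⁻¹ * (∑ i, fun z : Fin N → α × β => φ (z i)) z := by
      ext z; simp [hA]
    rw [h3, variance_const_mul, h1]
    simp only [Finset.sum_const, Finset.card_univ, Fintype.card_fin, nsmul_eq_mul, sub_zero] at *
    calc (N : ℝ)⁻¹ ^ 2 * (N * Var[φ; P.prod ν]) = Var[φ; P.prod ν] / N := by field_simp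
      _ ≤ _ := by gcongr
  have hAm : Measurable A := by fun_prop
  have hAL : MemLp A 2 Q := by
    refine memLp_of_bounded (a := 0) (b := b) (ae_of_all _ fun z => ?_) hAm.aestronglyMeasurable 2
    constructor
    · exact mul_nonneg (by positivity) (Finset.sum_nonneg fun i _ => (hb _).1)
    · calc A z ≤ (N : ℝ)⁻¹ * ∑ _i : Fin N, b := by
            simp only [hA]; gcongr with i; exact (hb _).2
        _ = b := by simp; field_simp
  -- The variance computation lives on `N` independent pairs; this equivalence carries it to a pair
  -- of independent samples.
  have hmp := measurePreserving_arrowProdEquivProdArrow α β (Fin N) (fun _ => P) (fun _ => ν)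
  have hset : MeasurableSet {w : (Fin N → α) × (Fin N → β) |
      δ ≤ |(N : ℝ)⁻¹ * (∑ i, φ (w.1 i, w.2 i)) - ∫ z, φ z ∂(P.prod ν)|} :=
    measurableSet_le measurable_const (by fun_prop)
  rw [← hmp.measure_preimage hset.nullMeasurableSet]
  calc _ = Q {z | δ ≤ |A z - ∫ z, A z ∂Q|} := by rw [hmean]; rfl
    _ ≤ ENNReal.ofReal (Var[A; Q] / δ ^ 2) := meas_ge_le_variance_div_sq hAL hδ
    _ ≤ _ := by gcongr

/-- A quadratic tail bound beyond `κ` gives a bound on the mean. -/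
lemma lintegral_le_of_sq_tail {Ω : Type*} [MeasurableSpace Ω] (Q : Measure Ω)
    [IsProbabilityMeasure Q] {η : Ω → ℝ} (hη : Measurable η) {κ V : ℝ}
    (hκ : 0 ≤ κ) (hV : 0 < V)
    (htail : ∀ δ, 0 < δ → Q {w | κ + δ < η w} ≤ ENNReal.ofReal (V ^ 2 / δ ^ 2)) :
    ∫⁻ w, ENNReal.ofReal (η w) ∂Q ≤ ENNReal.ofReal (κ + 2 * V) := by
  have h0 : ∀ w, 0 ≤ max (η w - κ) 0 := fun w => le_max_right _ _
  have hm : Measurable fun w => max (η w - κ) 0 := by fun_prop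
  have h1 : ∫⁻ w, ENNReal.ofReal (max (η w - κ) 0) ∂Q ≤ ENNReal.ofReal (2 * V) := by
    -- Layer cake, cut at `V`: probabilities are at most one below the cut, and `V ^ 2 / t ^ 2` is
    -- integrated above it. Each piece contributes `V`.
    rw [lintegral_eq_lintegral_meas_lt Q (ae_of_all _ h0) hm.aemeasurable,
      ← Set.Ioc_union_Ioi_eq_Ioi hV.le]
    refine (lintegral_union_le _ _ _).trans ?_
    have e1 : ∫⁻ t in Set.Ioc 0 V, Q {w | t < max (η w - κ) 0} ≤ ENNReal.ofReal V := by
      calc _ ≤ ∫⁻ t in Set.Ioc 0 V, 1 := lintegral_mono fun t => prob_le_one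
        _ = ENNReal.ofReal V := by simp
    have hint : IntegrableOn (fun t : ℝ => V ^ 2 * t ^ (-2 : ℝ)) (Set.Ioi V) :=
      (integrableOn_Ioi_rpow_of_lt (by norm_num) hV).const_mul _
    have e2 : ∫⁻ t in Set.Ioi V, Q {w | t < max (η w - κ) 0} ≤ ENNReal.ofReal V := by
      calc _ ≤ ∫⁻ t in Set.Ioi V, ENNReal.ofReal (V ^ 2 * t ^ (-2 : ℝ)) := by
            refine setLIntegral_mono' measurableSet_Ioi fun t ht => ?_
            have ht0 : 0 < t := hV.trans ht
            have : {w | t < max (η w - κ) 0} ⊆ {w | κ + t < η w} := by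
              intro w hw
              rcases lt_max_iff.1 (show t < max (η w - κ) 0 from hw) with h | h
              · show κ + t < η w
                linarith
              · linarith
            refine (measure_mono this).trans ((htail t ht0).trans (le_of_eq ?_))
            rw [Real.rpow_neg ht0.le, div_eq_mul_inv]
            norm_cast
        _ = ENNReal.ofReal (∫ t in Set.Ioi V, V ^ 2 * t ^ (-2 : ℝ)) := by
            rw [ofReal_integral_eq_lintegral_ofReal hint]
            refine (ae_restrict_iff' measurableSet_Ioi).2 (ae_of_all _ fun t ht => ?_)
            have ht0 : 0 < t := hV.trans ht
            positivity
        _ = ENNReal.ofReal V := by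
            rw [integral_const_mul, integral_Ioi_rpow_of_lt (by norm_num) hV]
            congr 1
            norm_num [Real.rpow_neg hV.le]
            field_simp
    calc _ ≤ ENNReal.ofReal V + ENNReal.ofReal V := add_le_add e1 e2
      _ = ENNReal.ofReal (2 * V) := by rw [← ENNReal.ofReal_add hV.le hV.le]; congr 1; ring
  calc ∫⁻ w, ENNReal.ofReal (η w) ∂Q
      ≤ ∫⁻ w, (ENNReal.ofReal κ + ENNReal.ofReal (max (η w - κ) 0)) ∂Q := by
        refine lintegral_mono fun w => ?_
        show ENNReal.ofReal (η w) ≤ ENNReal.ofReal κ + ENNReal.ofReal (max (η w - κ) 0)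
        rw [← ENNReal.ofReal_add hκ (h0 w)]
        refine ENNReal.ofReal_le_ofReal ?_
        have := le_max_left (η w - κ) 0
        linarith
    _ = ENNReal.ofReal κ + ∫⁻ w, ENNReal.ofReal (max (η w - κ) 0) ∂Q := by
        rw [lintegral_add_left measurable_const]; simp
    _ ≤ ENNReal.ofReal κ + ENNReal.ofReal (2 * V) := by gcongr
    _ = _ := by rw [← ENNReal.ofReal_add hκ (by positivity)]

/-- Mean error, measured through a continuous length function `G`, of the generalized inverse
`lh` of an empirical length function `Gh`. Only pointwise deviations of `Gh` are needed. -/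
lemma lintegral_empirical_quantile_error_le {Ω : Type*} [MeasurableSpace Ω] (Q : Measure Ω)
    [IsProbabilityMeasure Q] {Gh : Ω → ℝ → ℝ} {G : ℝ → ℝ} {lh : Ω → ℝ} {l κ V T : ℝ}
    (hcont : Continuous G) (hanti : Antitone G) (hG0 : ∀ t, 0 ≤ G t) (hT : 0 ≤ T) (hGT : G T = 0)
    (hl0 : 0 ≤ l) (hl : l ≤ G 0) (hlm : Measurable lh) (hlh0 : ∀ w, 0 ≤ lh w)
    (h1 : ∀ w t, 0 ≤ t → lh w < t → Gh w t ≤ l) (h2 : ∀ w t, 0 ≤ t → t < lh w → l < Gh w t)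
    (hκ : 0 ≤ κ) (hV : 0 < V)
    (hdev : ∀ t δ, 0 < δ → Q {w | κ + δ ≤ |Gh w t - G t|} ≤ ENNReal.ofReal (V ^ 2 / δ ^ 2)) :
    ∫⁻ w, ENNReal.ofReal |G (lh w) - l| ∂Q ≤ ENNReal.ofReal (κ + 4 * V) := by
  have hGm : Measurable fun w => |G (lh w) - l| :=
    ((hcont.measurable.comp hlm).sub_const l).abs
  -- A value `c` in the range of `G` is attained at a deterministic `t`, where the pointwise
  -- deviation bound applies; for `c` out of range the event is empty.
  have key : ∀ c δ, 0 < δ → ∀ E : Set Ω, (0 ≤ c → c ≤ G 0 → ∀ t, 0 ≤ t → G t = c →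
      E ⊆ {w | κ + δ ≤ |Gh w t - G t|}) → (c < 0 → E = ∅) → (G 0 < c → E = ∅) →
      Q E ≤ ENNReal.ofReal (V ^ 2 / δ ^ 2) := by
    intro c δ hδ E hE hE1 hE2
    rcases lt_or_ge c 0 with hc | hc
    · simp [hE1 hc]
    rcases lt_or_ge (G 0) c with hc' | hc'
    · simp [hE2 hc']
    obtain ⟨t, ht, rfl⟩ := intermediate_value_Icc' hT hcont.continuousOn
      (show c ∈ Set.Icc (G T) (G 0) from ⟨hGT ▸ hc, hc'⟩)
    exact (measure_mono (hE hc hc' t ht.1 rfl)).trans (hdev t δ hδ)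
  -- The two one-sided events sum to `2 V ^ 2 / δ ^ 2`, which is at most `(2 V) ^ 2 / δ ^ 2`.
  have h := lintegral_le_of_sq_tail Q hGm hκ (V := 2 * V) (by positivity) fun δ hδ => by
    have e1 : Q {w | l + (κ + δ) < G (lh w)} ≤ ENNReal.ofReal (V ^ 2 / δ ^ 2) := by
      refine key (l + (κ + δ)) δ hδ _ (fun _ _ t ht hGt w hw => ?_) (fun hc => ?_) (fun hc => ?_)
      · have hlt : lh w < t := by
          by_contra hcon
          have := hanti (not_lt.1 hcon)
          have : l + (κ + δ) < G (lh w) := hw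
          linarith
        have := h1 w t ht hlt
        show κ + δ ≤ |Gh w t - G t|
        rw [abs_sub_comm]
        refine le_trans ?_ (le_abs_self _)
        linarith
      · refine Set.eq_empty_of_forall_notMem fun w hw => ?_
        have hw' : l + (κ + δ) < G (lh w) := hw
        linarith
      · refine Set.eq_empty_of_forall_notMem fun w hw => ?_
        have hw' : l + (κ + δ) < G (lh w) := hw
        have := hanti (hlh0 w)
        linarith
    have e2 : Q {w | G (lh w) < l - (κ + δ)} ≤ ENNReal.ofReal (V ^ 2 / δ ^ 2) := by
      refine key (l - (κ + δ)) δ hδ _ (fun _ _ t ht hGt w hw => ?_) (fun hc => ?_) (fun hc => ?_)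
      · have hlt : t < lh w := by
          by_contra hcon
          have := hanti (not_lt.1 hcon)
          have : G (lh w) < l - (κ + δ) := hw
          linarith
        have := h2 w t ht hlt
        show κ + δ ≤ |Gh w t - G t|
        refine le_trans ?_ (le_abs_self _)
        linarith
      · refine Set.eq_empty_of_forall_notMem fun w hw => ?_
        have hw' : G (lh w) < l - (κ + δ) := hw
        have := hG0 (lh w)
        linarith
      · linarith
    have hsub : {w | κ + δ < |G (lh w) - l|} ⊆
        {w | l + (κ + δ) < G (lh w)} ∪ {w | G (lh w) < l - (κ + δ)} := by
      intro w hw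
      rcases lt_abs.1 (show κ + δ < |G (lh w) - l| from hw) with h | h
      · left; show l + (κ + δ) < G (lh w); linarith
      · right; show G (lh w) < l - (κ + δ); linarith
    calc _ ≤ _ := (measure_mono hsub).trans (measure_union_le _ _)
      _ ≤ ENNReal.ofReal (V ^ 2 / δ ^ 2) + ENNReal.ofReal (V ^ 2 / δ ^ 2) := add_le_add e1 e2
      _ = ENNReal.ofReal (V ^ 2 / δ ^ 2 + V ^ 2 / δ ^ 2) := by
          rw [ENNReal.ofReal_add] <;> positivity
      _ ≤ _ := by
          refine ENNReal.ofReal_le_ofReal ?_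
          rw [← add_div]
          gcongr
          nlinarith [sq_nonneg V]
  refine h.trans (ENNReal.ofReal_le_ofReal (by linarith))

end Sampling

/-! ### Generalized inverses and continuity of survival functions. -/

section GenInv

variable {G : ℝ → ℝ≥0∞} {a : ℝ}

lemma genInv_nonneg (G : ℝ → ℝ≥0∞) (a : ℝ) : 0 ≤ genInv G a :=
  Real.sInf_nonneg fun _ h => h.1

/-- `hne` excludes the default value `sInf ∅ = 0`. -/
lemma le_of_genInv_lt (hG : Antitone G) (hne : ∃ t, 0 ≤ t ∧ G t ≤ ENNReal.ofReal a) {t : ℝ}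
    (h : genInv G a < t) : G t ≤ ENNReal.ofReal a := by
  obtain ⟨r, hr, hrt⟩ := exists_lt_of_csInf_lt hne h
  exact (hG hrt.le).trans hr.2

lemma lt_of_lt_genInv {t : ℝ} (ht : 0 ≤ t) (h : t < genInv G a) : ENNReal.ofReal a < G t := by
  by_contra hc
  exact absurd h (not_lt.2 (csInf_le ⟨0, fun _ h => h.1⟩ ⟨ht, not_lt.1 hc⟩))

lemma le_genInv (hne : ∃ t, 0 ≤ t ∧ G t ≤ ENNReal.ofReal a) {b : ℝ}
    (h : ∀ t, 0 ≤ t → t < b → ENNReal.ofReal a < G t) : b ≤ genInv G a := by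
  refine le_csInf hne fun t ht => ?_
  by_contra hc
  exact absurd (h t ht.1 (not_le.1 hc)) (not_lt.2 ht.2)

/-- By monotonicity, an infimum below `b` is already witnessed by a rational level, so the event is
a countable union. -/
lemma measurable_genInv {Ω : Type*} [MeasurableSpace Ω] {G : Ω → ℝ → ℝ≥0∞}
    (hm : ∀ t, Measurable fun w => G w t) (hG : ∀ w, Antitone (G w))
    (hne : ∀ w, ∃ t, 0 ≤ t ∧ G w t ≤ ENNReal.ofReal a) :
    Measurable fun w => genInv (G w) a := by
  refine measurable_of_Iio fun b => ?_
  have : (fun w => genInv (G w) a) ⁻¹' Set.Iio b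
      = ⋃ r : ℚ, {w | ((0 : ℝ) ≤ r ∧ (r : ℝ) < b) ∧ G w r ≤ ENNReal.ofReal a} := by
    ext w
    simp only [Set.mem_preimage, Set.mem_Iio, Set.mem_iUnion, Set.mem_ofPred_eq]
    constructor
    · intro h
      obtain ⟨x, hx, hxb⟩ := exists_lt_of_csInf_lt (hne w) h
      obtain ⟨r, hr1, hr2⟩ := exists_rat_btwn hxb
      exact ⟨r, ⟨hx.1.trans hr1.le, hr2⟩, (hG w hr1.le).trans hx.2⟩
    · rintro ⟨r, ⟨h0, hb⟩, h⟩
      have h1 : genInv (G w) a ≤ r := csInf_le ⟨0, fun _ h => h.1⟩ ⟨h0, h⟩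
      exact h1.trans_lt hb
  rw [this]
  refine MeasurableSet.iUnion fun r => ?_
  exact (MeasurableSet.const _).inter (measurableSet_le (hm _) measurable_const)

end GenInv

/-- The survival function of a function without atoms is continuous. -/
lemma continuous_measureReal_superlevel {Ω : Type*} [MeasurableSpace Ω] (m : Measure Ω)
    [IsFiniteMeasure m] {q : Ω → ℝ} (hq : Measurable q) (h0 : ∀ t, m {w | q w = t} = 0) :
    Continuous fun t => m.real {w | t ≤ q w} := by
  have e : (fun t => m.real {w | t ≤ q w})
      = fun t => ∫ w, ({w | t ≤ q w} : Set Ω).indicator (fun _ => (1 : ℝ)) w ∂m := by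
    ext t
    rw [integral_indicator (measurableSet_le measurable_const hq)]
    simp
  rw [e, continuous_iff_continuousAt]
  intro t
  refine continuousAt_of_dominated (bound := fun _ => 1)
    (Filter.Eventually.of_forall fun r => ?_) (Filter.Eventually.of_forall fun r => ?_)
    (integrable_const _) ?_
  · exact ((measurable_const (a := (1 : ℝ))).indicator
      (measurableSet_le measurable_const hq)).aestronglyMeasurable
  · refine ae_of_all _ fun w => ?_
    by_cases h : w ∈ {w | r ≤ q w} <;> simp [Set.indicator, h]
  -- Dominated convergence: off the null set `q = t`, the indicator is locally constant in the level
  -- near `t`.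
  · have : ∀ᵐ w ∂m, q w ≠ t := by
      rw [ae_iff]; simpa using h0 t
    filter_upwards [this] with w hw
    rcases lt_or_gt_of_ne hw with h | h
    · refine continuousAt_const.congr (f := fun _ => (0 : ℝ)) ?_
      filter_upwards [lt_mem_nhds h] with r hr
      simp [not_le.2 hr]
    · refine continuousAt_const.congr (f := fun _ => (1 : ℝ)) ?_
      filter_upwards [gt_mem_nhds h] with r hr
      simp [le_of_lt hr]

/-! ### Riemann sums of interval indicators. -/

section Grid

/-- The number of integer points of an order-connected subset of `[0, M]` is its length up to
one. -/
lemma abs_card_sub_volume_le_one {M : ℕ} {J : Set ℝ} (hJ : J.OrdConnected)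
    (hJM : J ⊆ Set.Icc 0 (M : ℝ)) [DecidablePred fun k : ℕ => (k : ℝ) ∈ J] :
    |(((Finset.range M).filter fun k : ℕ => (k : ℝ) ∈ J).card : ℝ) - volume.real J| ≤ 1 := by
  rcases J.eq_empty_or_nonempty with rfl | hne
  · simp
  have hbb : BddBelow J := ⟨0, fun x hx => (hJM hx).1⟩
  have hba : BddAbove J := ⟨M, fun x hx => (hJM hx).2⟩
  set a := sInf J
  set b := sSup J
  have ha0 : 0 ≤ a := le_csInf hne fun x hx => (hJM hx).1
  have hbM : b ≤ M := csSup_le hne fun x hx => (hJM hx).2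
  have hab : a ≤ b := csInf_le_csSup hne hbb hba
  have hsub : J ⊆ Set.Icc a b := fun x hx => ⟨csInf_le hbb hx, le_csSup hba hx⟩
  have hsup : Set.Ioo a b ⊆ J := by
    intro x hx
    obtain ⟨y, hy, hyx⟩ := exists_lt_of_csInf_lt hne hx.1
    obtain ⟨z, hz, hxz⟩ := exists_lt_of_lt_csSup hne hx.2
    exact hJ.out hy hz ⟨hyx.le, hxz.le⟩
  have hvol : volume.real J = b - a := by
    refine le_antisymm ?_ ?_
    · calc volume.real J ≤ volume.real (Set.Icc a b) := measureReal_mono hsub (by simp)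
        _ = b - a := by simp [hab]
    · calc b - a = volume.real (Set.Ioo a b) := by simp [hab]
        _ ≤ volume.real J := measureReal_mono hsup
            (measure_ne_top_of_subset hsub (by simp))
  set F := (Finset.range M).filter fun k : ℕ => (k : ℝ) ∈ J
  have hF1 : F ⊆ Finset.Icc ⌈a⌉₊ ⌊b⌋₊ := by
    intro k hk
    have := hsub (Finset.mem_filter.1 hk).2
    exact Finset.mem_Icc.2 ⟨Nat.ceil_le.2 this.1, Nat.le_floor this.2⟩
  have hF2 : Finset.Ioo ⌊a⌋₊ ⌈b⌉₊ ⊆ F := by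
    intro k hk
    obtain ⟨h1, h2⟩ := Finset.mem_Ioo.1 hk
    have h1' := (Nat.floor_lt ha0).1 h1
    have h2' := Nat.lt_ceil.1 h2
    refine Finset.mem_filter.2 ⟨Finset.mem_range.2 ?_, hsup ⟨h1', h2'⟩⟩
    exact_mod_cast h2'.trans_le hbM
  have c1 := Finset.card_le_card hF1
  have c2 := Finset.card_le_card hF2
  rw [Nat.card_Icc] at c1
  rw [Nat.card_Ioo] at c2
  have c1' : (F.card : ℝ) ≤ b - a + 1 := by
    have h1 := Nat.le_ceil a
    have h2 := Nat.floor_le (ha0.trans hab)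
    -- The cardinality of the integer interval is a truncated subtraction; when it truncates, no
    -- integer point is left.
    rcases le_or_gt ⌈a⌉₊ (⌊b⌋₊ + 1) with h | h
    · have : (F.card : ℝ) ≤ ((⌊b⌋₊ + 1 - ⌈a⌉₊ : ℕ) : ℝ) := by exact_mod_cast c1
      rw [Nat.cast_sub h] at this
      push_cast at this
      linarith
    · have : F.card = 0 := by omega
      rw [this]; push_cast; linarith
  have c2' : b - a - 1 ≤ F.card := by
    have h1 := Nat.floor_le ha0
    have h2 := Nat.le_ceil b
    have : (⌈b⌉₊ : ℝ) ≤ F.card + ⌊a⌋₊ + 1 := by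
      have : ⌈b⌉₊ ≤ F.card + ⌊a⌋₊ + 1 := by omega
      exact_mod_cast this
    linarith
  rw [hvol, abs_le]
  constructor <;> linarith

/-- The Riemann sum of the indicator of an order-connected subset of `[-s, s]` over the regular
grid is its length up to one mesh. -/
lemma abs_grid_sum_sub_volume_le {s : ℝ} (hs : 0 < s) {M : ℕ} (hM : 0 < M) {I : Set ℝ}
    (hI : I.OrdConnected) (hIs : I ⊆ Set.Icc (-s) s)
    [DecidablePred fun k : ℕ => gridPt s M k ∈ I] :
    |2 * s / M * (((Finset.range M).filter fun k : ℕ => gridPt s M k ∈ I).card : ℝ)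
      - volume.real I| ≤ 2 * s / M := by
  have hMR : (0 : ℝ) < M := Nat.cast_pos.2 hM
  set h := 2 * s / M with hh
  have hpos : 0 < h := by positivity
  -- This affine rescaling turns the grid points into the integers `0, …, M - 1`.
  set J : Set ℝ := (fun t => h * t + -s) ⁻¹' I with hJdef
  have hJ : J.OrdConnected := hI.preimage_mono fun x y hxy => by
    show h * x + -s ≤ h * y + -s
    gcongr
  have hJM : J ⊆ Set.Icc 0 (M : ℝ) := by
    intro t ht
    obtain ⟨h1, h2⟩ := hIs (show h * t + -s ∈ I from ht)
    have h3 : h * M = 2 * s := by rw [hh]; field_simp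
    constructor
    · by_contra hc
      nlinarith [not_le.1 hc]
    · by_contra hc
      nlinarith [not_le.1 hc]
  have hg : ∀ k : ℕ, gridPt s M k = h * k + -s := by
    intro k; rw [gridPt, hh]; ring
  have hvol : volume.real I = h * volume.real J := by
    have e : J = (fun t => h * t) ⁻¹' ((fun t => t + -s) ⁻¹' I) := rfl
    rw [Measure.real, Measure.real, e, Real.volume_preimage_mul_left hpos.ne',
      measure_preimage_add_right, ENNReal.toReal_mul, ENNReal.toReal_ofReal (abs_nonneg _),
      abs_of_pos (inv_pos.2 hpos)]
    field_simp
  classical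
  have hc := abs_card_sub_volume_le_one hJ hJM
  have hcard : ((Finset.range M).filter fun k : ℕ => gridPt s M k ∈ I)
      = (Finset.range M).filter fun k : ℕ => (k : ℝ) ∈ J := by
    ext k
    simp only [Finset.mem_filter, hg]
    rfl
  rw [hvol, hcard, ← mul_sub, abs_mul, abs_of_pos hpos]
  calc _ ≤ h * 1 := by gcongr
    _ = h := mul_one h

end Grid

/-! ### Gaussian densities: shape, level sets and tails. -/

section Gaussian

lemma gaussianPDFReal_le_of_sq_le {μ : ℝ} {v : NNReal} {x y : ℝ}
    (h : (y - μ) ^ 2 ≤ (x - μ) ^ 2) : gaussianPDFReal μ v x ≤ gaussianPDFReal μ v y := by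
  unfold gaussianPDFReal
  gcongr

lemma gaussianPDFReal_le_inv_sqrt (μ : ℝ) (v : NNReal) (x : ℝ) :
    gaussianPDFReal μ v x ≤ (√(2 * Real.pi * v))⁻¹ := by
  unfold gaussianPDFReal
  refine mul_le_of_le_one_right (by positivity) (Real.exp_le_one_iff.2 ?_)
  rw [neg_div]
  exact neg_nonpos.2 (by positivity)

/-- Strict superlevel sets of a Gaussian density are order-connected. -/
lemma ordConnected_lt_gaussianPDFReal (μ : ℝ) (v : NNReal) (t : ℝ) :
    {y | t < gaussianPDFReal μ v y}.OrdConnected := by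
  refine ⟨fun a ha b hb y hy => ?_⟩
  have ha' : t < gaussianPDFReal μ v a := ha
  have hb' : t < gaussianPDFReal μ v b := hb
  show t < gaussianPDFReal μ v y
  rcases le_total y μ with h | h
  · refine ha'.trans_le (gaussianPDFReal_le_of_sq_le ?_)
    nlinarith [hy.1]
  · refine hb'.trans_le (gaussianPDFReal_le_of_sq_le ?_)
    nlinarith [hy.2]

/-- Level sets of a Gaussian density are null. -/
lemma volume_gaussianPDFReal_eq (μ : ℝ) {v : NNReal} (hv : v ≠ 0) (t : ℝ) :
    volume {y | gaussianPDFReal μ v y = t} = 0 := by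
  rcases Set.eq_empty_or_nonempty {y | gaussianPDFReal μ v y = t} with h | ⟨a, ha⟩
  · simp [h]
  refine measure_mono_null (t := {a, 2 * μ - a}) (fun y hy => ?_) ?_
  · have e : gaussianPDFReal μ v y = gaussianPDFReal μ v a := Eq.trans hy (Eq.symm ha)
    have hv' : (0 : ℝ) < v := NNReal.coe_pos.2 (pos_iff_ne_zero.2 hv)
    unfold gaussianPDFReal at e
    have e2 := Real.exp_injective (mul_left_cancel₀ (by positivity) e)
    have e3 : (y - μ) ^ 2 = (a - μ) ^ 2 := by
      field_simp at e2
      linarith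
    rcases sq_eq_sq_iff_eq_or_eq_neg.1 e3 with h | h
    · left; linarith
    · right; show y = 2 * μ - a; linarith
  · exact (Set.toFinite _).measure_zero _

/-- Exponential tail bound for a Gaussian density with bounded mean and variance. -/
lemma lintegral_gaussian_tail_le {μ B r : ℝ} {v : NNReal} {V : ℝ} (hv : v ≠ 0) (hμ : |μ| ≤ B)
    (hV : (v : ℝ) ≤ V) (hr : 0 ≤ r) (s : ℝ) :
    ∫⁻ y in {y | |y| ≤ s}ᶜ, ENNReal.ofReal (gaussianPDFReal μ v y)
      ≤ ENNReal.ofReal (2 * Real.exp (B * r + V * r ^ 2 / 2) * Real.exp (-(r * s))) := by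
  have hid : (gaussianReal μ v).map id = gaussianReal μ v := Measure.map_id
  have hneg : (gaussianReal μ v).map (fun x => -x) = gaussianReal (-μ) v := gaussianReal_map_neg
  -- One Chernoff bound serves both tails, with `X` the identity and then its negative; hence the
  -- factor two.
  have key : ∀ (X : ℝ → ℝ) (μ' : ℝ), |μ'| ≤ B → (gaussianReal μ v).map X = gaussianReal μ' v →
      Integrable (fun ω => Real.exp (r * X ω)) (gaussianReal μ v) →
      (gaussianReal μ v) {y | s ≤ X y}
        ≤ ENNReal.ofReal (Real.exp (B * r + V * r ^ 2 / 2) * Real.exp (-(r * s))) := by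
    intro X μ' hμ' hX hint
    have h := measure_ge_le_exp_mul_mgf (X := X) (μ := gaussianReal μ v) s hr hint
    rw [mgf_gaussianReal hX] at h
    have hle : Real.exp (μ' * r + v * r ^ 2 / 2) ≤ Real.exp (B * r + V * r ^ 2 / 2) := by
      have := (abs_le.1 hμ').2
      gcongr
    rw [← ofReal_measureReal]
    refine ENNReal.ofReal_le_ofReal (h.trans ?_)
    rw [mul_comm, neg_mul]
    gcongr
  rw [show (∫⁻ y in {y | |y| ≤ s}ᶜ, ENNReal.ofReal (gaussianPDFReal μ v y))
    = gaussianReal μ v {y | |y| ≤ s}ᶜ from (gaussianReal_apply μ hv _).symm]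
  have hsub : {y : ℝ | |y| ≤ s}ᶜ ⊆ {y | s ≤ id y} ∪ {y | s ≤ -y} := by
    intro y hy
    rcases lt_abs.1 (not_le.1 (show ¬ |y| ≤ s from hy)) with h | h
    · left; exact le_of_lt (a := s) (b := y) h
    · right; exact le_of_lt (a := s) (b := -y) h
  have k1 := key id μ hμ hid (integrable_exp_mul_gaussianReal r)
  have k2 := key (fun x => -x) (-μ) (by rwa [abs_neg]) hneg (by
    simpa using integrable_exp_mul_gaussianReal (μ := μ) (v := v) (-r))
  calc _ ≤ _ := (measure_mono hsub).trans (measure_union_le _ _)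
    _ ≤ _ := add_le_add k1 k2
    _ = _ := by
      rw [← ENNReal.ofReal_add (by positivity) (by positivity)]
      congr 1; ring

end Gaussian

/-! ### Thresholded variance, exact calibration of a level, and the law of `(X, Y)`. -/

lemma threshVar_pos {s : ℝ} (hs : 0 < s) (v : ℝ) : 0 < threshVar s v := by
  have hs' : 0 < s⁻¹ := inv_pos.2 hs
  unfold threshVar
  have h1 : 0 ≤ (if s⁻¹ ≤ v ∧ v ≤ s then v else 0) := by
    split_ifs with h
    · exact hs'.le.trans h.1
    · exact le_rfl
  have h2 : 0 ≤ (if v < s⁻¹ then s⁻¹ else 0) := by positivity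
  have h3 : 0 ≤ (if s < v then s else 0) := by positivity
  -- For `s < 1` the three cases are not mutually exclusive, so the argument only uses that one term
  -- is positive and the others nonnegative.
  by_cases a : v < s⁻¹
  · have e : (if v < s⁻¹ then s⁻¹ else 0) = s⁻¹ := if_pos a
    linarith
  · by_cases b : s < v
    · have e : (if s < v then s else 0) = s := if_pos b
      linarith
    · have e : (if s⁻¹ ≤ v ∧ v ≤ s then v else 0) = v := if_pos ⟨not_lt.1 a, not_lt.1 b⟩
      linarith

lemma threshVar_toNNReal_ne_zero {s : ℝ} (hs : 0 < s) (v : ℝ) : (threshVar s v).toNNReal ≠ 0 :=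
  (Real.toNNReal_pos.2 (threshVar_pos hs v)).ne'

/-- A threshold defined by the generalized inverse of the superlevel measure of an atomless
density is positive and attained exactly. -/
lemma genInv_superlevel {Ω : Type*} [MeasurableSpace Ω] {m : Measure Ω} {p : Ω → ℝ}
    (hpm : Measurable p) (hp0 : ∀ w, 0 < p w) {P : ℝ} (hP : ∀ w, p w ≤ P) (hp : Integrable p m)
    (huniv : m Set.univ = ∞) (hatom : ∀ t, m {w | p w = t} = 0) {l : ℝ} (hl : 0 < l) :
    0 < genInv (fun t => m {w | t ≤ p w}) l ∧
      m {w | genInv (fun t => m {w | t ≤ p w}) l ≤ p w} = ENNReal.ofReal l := by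
  set G : ℝ → ℝ≥0∞ := fun t => m {w | t ≤ p w} with hG
  have hanti : Antitone G := fun a b hab => measure_mono fun w hw => hab.trans hw
  have hne : ∃ t, 0 ≤ t ∧ G t ≤ ENNReal.ofReal l := by
    refine ⟨max 0 (P + 1), le_max_left _ _, ?_⟩
    have : {w | max 0 (P + 1) ≤ p w} = ∅ := by
      refine Set.eq_empty_of_forall_notMem fun w hw => ?_
      have h1 : max 0 (P + 1) ≤ p w := hw
      have h2 := le_max_right 0 (P + 1)
      linarith [hP w]
    show m {w | max 0 (P + 1) ≤ p w} ≤ _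
    simp only [this, measure_empty, zero_le]
  have hfin : ∀ t, 0 < t → G t ≠ ∞ := fun t ht => (hp.measure_ge_lt_top ht).ne
  set lam := genInv G l with hlam
  have hpos : 0 < lam := by
    -- As `p > 0`, the sets `{1 / (n + 1) ≤ p}` exhaust a space of infinite measure, so some
    -- positive level still has measure above `l`.
    have ht : Filter.Tendsto (fun n : ℕ => G (1 / ((n : ℝ) + 1))) Filter.atTop
        (nhds (m (⋃ n : ℕ, {w | 1 / ((n : ℝ) + 1) ≤ p w}))) := by
      refine tendsto_measure_iUnion_atTop fun a b hab w hw => ?_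
      have h1 : 1 / ((a : ℝ) + 1) ≤ p w := hw
      exact (Nat.one_div_le_one_div hab).trans h1
    have hU : (⋃ n : ℕ, {w | 1 / ((n : ℝ) + 1) ≤ p w}) = Set.univ := by
      refine Set.eq_univ_of_forall fun w => ?_
      obtain ⟨n, hn⟩ := exists_nat_one_div_lt (hp0 w)
      exact Set.mem_iUnion.2 ⟨n, hn.le⟩
    rw [hU, huniv] at ht
    obtain ⟨n, hn⟩ := (ht.eventually (lt_mem_nhds (ENNReal.ofReal_lt_top (r := l)))).exists
    exact (by positivity : (0 : ℝ) < 1 / ((n : ℝ) + 1)).trans_le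
      (le_genInv hne fun t _ htn => hn.trans_le (hanti htn.le))
  refine ⟨hpos, ?_⟩
  -- Since `m` is infinite, continuity is obtained on `{lam / 2 ≤ p}`, of finite measure by
  -- integrability. Limits at `lam` from the left and from the right then give the two inequalities.
  set a := lam / 2
  have ha : 0 < a := by positivity
  have hal : a < lam := half_lt_self hpos
  have : IsFiniteMeasure (m.restrict {w | a ≤ p w}) :=
    ⟨by rw [Measure.restrict_apply_univ]; exact lt_top_iff_ne_top.2 (hfin a ha)⟩
  have hc := continuous_measureReal_superlevel (m.restrict {w | a ≤ p w}) hpm fun t =>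
    le_antisymm ((Measure.restrict_apply_le _ _).trans (hatom t).le) zero_le
  set H : ℝ → ℝ := fun t => (m.restrict {w | a ≤ p w}).real {w | t ≤ p w} with hH
  have hHG : ∀ t, a ≤ t → ENNReal.ofReal (H t) = G t := by
    intro t hat
    simp only [hH]
    rw [ofReal_measureReal, Measure.restrict_apply (measurableSet_le measurable_const hpm)]
    congr 1
    exact Set.inter_eq_self_of_subset_left fun w hw => hat.trans hw
  have hH0 : ∀ t, 0 ≤ H t := fun t => measureReal_nonneg
  have h1 : l ≤ H lam := by
    refine ge_of_tendsto (hc.continuousWithinAt (s := Set.Iio lam) (x := lam)) ?_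
    filter_upwards [Ioo_mem_nhdsLT hal] with t ht
    have := lt_of_lt_genInv (ha.le.trans ht.1.le) ht.2
    rw [← hHG t ht.1.le] at this
    exact (ENNReal.ofReal_lt_ofReal_iff'.1 this).1.le
  have h2 : H lam ≤ l := by
    refine le_of_tendsto (hc.continuousWithinAt (s := Set.Ioi lam) (x := lam)) ?_
    filter_upwards [self_mem_nhdsWithin] with t ht
    have := le_of_genInv_lt hanti hne (show genInv G l < t from ht)
    rw [← hHG t (hal.le.trans (le_of_lt ht))] at this
    exact (ENNReal.ofReal_le_ofReal_iff hl.le).1 this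
  show G lam = _
  rw [← hHG lam hal.le, le_antisymm h2 h1]

lemma toNNReal_sq_ne_zero {a : ℝ} (h : 0 < a) : (a ^ 2).toNNReal ≠ 0 :=
  (Real.toNNReal_pos.2 (by positivity)).ne'

lemma gaussianReal_map_affine (a b : ℝ) :
    (gaussianReal 0 1).map (fun e => a + b * e) = gaussianReal a (b ^ 2).toNNReal := by
  have h : (fun e : ℝ => a + b * e) = (fun e => a + e) ∘ fun e => b * e := rfl
  rw [h, ← Measure.map_map (by fun_prop) (by fun_prop), gaussianReal_map_const_mul,
    gaussianReal_map_const_add]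
  congr 1
  · ring
  · ext
    simp [Real.coe_toNNReal _ (sq_nonneg b)]

/-- Given `x`, the response is an affine image of a standard Gaussian; `σ x > 0` ensures that it has
a density. -/
lemma jointLaw_apply {d : ℕ} (PX : Measure (Feat d)) {f σ : Feat d → ℝ} (hf : Measurable f) (hσ : Measurable σ) (hσ0 : ∀ x, 0 < σ x)
    {D : Set (Feat d × ℝ)} (hD : MeasurableSet D) :
    jointLaw PX f σ D
      = ∫⁻ x, (∫⁻ y in {y | (x, y) ∈ D}, ENNReal.ofReal (condDens f σ x y)) ∂PX := by
  have hT : Measurable fun w : Feat d × ℝ => (w.1, f w.1 + σ w.1 * w.2) := by fun_prop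
  rw [jointLaw, Measure.map_apply hT hD, Measure.prod_apply (hT hD)]
  refine lintegral_congr fun x => ?_
  have h1 : MeasurableSet {y | (x, y) ∈ D} := measurable_prodMk_left hD
  have h2 := gaussianReal_apply (f x) (toNNReal_sq_ne_zero (hσ0 x)) {y | (x, y) ∈ D}
  rw [← gaussianReal_map_affine, Measure.map_apply (by fun_prop) h1] at h2
  exact h2

/-! ### The model on triples: risk, oracle level and tail mass. -/

section Model

variable {d : ℕ} (PX : Measure (Feat d)) [IsProbabilityMeasure PX] (ν : Measure ℝ)
  [IsProbabilityMeasure ν] {f σ : Feat d → ℝ}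

/-- The reference measure `PX ⊗ ν ⊗ Leb` for triples `((x, z), y)`. -/
noncomputable def refMeasure (PX : Measure (Feat d)) (ν : Measure ℝ) : Measure ((Feat d × ℝ) × ℝ) :=
  (PX.prod ν).prod volume

/-- The conditional density as a function of the triple `((x, z), y)`. -/
noncomputable def tripleDens (f σ : Feat d → ℝ) (w : (Feat d × ℝ) × ℝ) : ℝ := condDens f σ w.1.1 w.2

lemma measurable_tripleDens (hf : Measurable f) (hσ : Measurable σ) :
    Measurable (tripleDens f σ) := by
  unfold tripleDens condDens gaussianPDFReal
  fun_prop

lemma tripleDens_pos (hσ0 : ∀ x, 0 < σ x) (w : (Feat d × ℝ) × ℝ) : 0 < tripleDens f σ w :=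
  gaussianPDFReal_pos _ _ _ (toNNReal_sq_ne_zero (hσ0 _))

lemma tripleDens_le {σ₀ : ℝ} (h0 : 0 < σ₀) (hσ0 : ∀ x, σ₀ ≤ σ x) (w : (Feat d × ℝ) × ℝ) :
    tripleDens f σ w ≤ (√(2 * Real.pi * σ₀ ^ 2))⁻¹ := by
  refine (gaussianPDFReal_le_inv_sqrt _ _ _).trans ?_
  rw [Real.coe_toNNReal _ (sq_nonneg _)]
  have := hσ0 w.1.1
  gcongr

/-- The randomization is integrated last, to match the slicing of `(jointLaw PX f σ).prod ν` over
`ν` in the risk. -/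
lemma lintegral_refMeasure {h : (Feat d × ℝ) × ℝ → ℝ≥0∞} (hh : Measurable h) :
    ∫⁻ w, h w ∂(refMeasure PX ν) = ∫⁻ z, (∫⁻ x, (∫⁻ y, h ((x, z), y)) ∂PX) ∂ν := by
  rw [refMeasure, lintegral_prod _ hh.aemeasurable,
    lintegral_prod_symm' _ hh.lintegral_prod_right']

/-- The risk as a functional of the graph of the predictor. -/
lemma risk_eq (hf : Measurable f) (hσ : Measurable σ) (hσ0 : ∀ x, 0 < σ x) (l : ℝ)
    {Γ : Feat d → ℝ → Set ℝ} {A : Set ((Feat d × ℝ) × ℝ)} (hA : MeasurableSet A)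
    (hAΓ : ∀ x z y, ((x, z), y) ∈ A ↔ y ∈ Γ x z) :
    risk PX f σ l ν Γ = ∫⁻ w in Aᶜ, ENNReal.ofReal (tripleDens f σ w) ∂(refMeasure PX ν)
      + ENNReal.ofReal (oracleLevel PX f σ l) * refMeasure PX ν A := by
  have hjp : SFinite (jointLaw PX f σ) := by unfold jointLaw; infer_instance
  unfold risk
  congr 1
  · have hE : MeasurableSet {w : (Feat d × ℝ) × ℝ | w.1.2 ∉ Γ w.1.1 w.2} := by
      have : {w : (Feat d × ℝ) × ℝ | w.1.2 ∉ Γ w.1.1 w.2}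
          = (fun w : (Feat d × ℝ) × ℝ => ((w.1.1, w.2), w.1.2)) ⁻¹' Aᶜ := by
        ext w; simp [hAΓ]
      rw [this]
      exact (by fun_prop : Measurable fun w : (Feat d × ℝ) × ℝ => ((w.1.1, w.2), w.1.2)) hA.compl
    have hm := (measurable_tripleDens hf hσ).ennreal_ofReal
    rw [← lintegral_indicator hA.compl, lintegral_refMeasure PX ν (hm.indicator hA.compl),
      Measure.prod_apply_symm hE]
    refine lintegral_congr fun z => ?_
    rw [jointLaw_apply PX hf hσ hσ0 (measurable_prodMk_right hE)]
    refine lintegral_congr fun x => ?_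
    have hs : MeasurableSet {y : ℝ | (x, y) ∈ (fun w => (w, z)) ⁻¹'
        {w : (Feat d × ℝ) × ℝ | w.1.2 ∉ Γ w.1.1 w.2}} :=
      measurable_prodMk_left (measurable_prodMk_right hE)
    rw [← lintegral_indicator hs]
    refine lintegral_congr fun y => ?_
    by_cases hy : y ∈ Γ x z
    · rw [Set.indicator_of_notMem (by simpa using hy),
        Set.indicator_of_notMem (by simpa [hAΓ] using hy)]
    · rw [Set.indicator_of_mem (by simpa using hy),
        Set.indicator_of_mem (by simpa [hAΓ] using hy)]
      rfl
  · congr 1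
    rw [refMeasure, Measure.prod_apply hA]
    refine lintegral_congr fun z => ?_
    congr 1
    ext y
    exact (hAΓ z.1 z.2 y).symm

lemma lintegral_tripleDens (hf : Measurable f) (hσ : Measurable σ) (hσ0 : ∀ x, 0 < σ x) :
    ∫⁻ w, ENNReal.ofReal (tripleDens f σ w) ∂(refMeasure PX ν) = 1 := by
  rw [lintegral_refMeasure PX ν (measurable_tripleDens hf hσ).ennreal_ofReal]
  have : ∀ z x, ∫⁻ y, ENNReal.ofReal (tripleDens f σ ((x, z), y)) = 1 := fun z x =>
    lintegral_gaussianPDFReal_eq_one (f x) (toNNReal_sq_ne_zero (hσ0 x))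
  simp [this]

lemma integrable_tripleDens (hf : Measurable f) (hσ : Measurable σ) (hσ0 : ∀ x, 0 < σ x) :
    Integrable (tripleDens f σ) (refMeasure PX ν) := by
  refine ⟨(measurable_tripleDens hf hσ).aestronglyMeasurable, ?_⟩
  rw [hasFiniteIntegral_iff_ofReal (ae_of_all _ fun w => (tripleDens_pos hσ0 w).le),
    lintegral_tripleDens PX ν hf hσ hσ0]
  exact ENNReal.one_lt_top

lemma integral_tripleDens (hf : Measurable f) (hσ : Measurable σ) (hσ0 : ∀ x, 0 < σ x) :
    ∫ w, tripleDens f σ w ∂(refMeasure PX ν) = 1 := by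
  rw [integral_eq_lintegral_of_nonneg_ae (ae_of_all _ fun w => (tripleDens_pos hσ0 w).le)
    (measurable_tripleDens hf hσ).aestronglyMeasurable, lintegral_tripleDens PX ν hf hσ hσ0,
    ENNReal.toReal_one]

/-- Sets that do not depend on the randomization. -/
lemma refMeasure_apply_of_pair {D : Set (Feat d × ℝ)} (hD : MeasurableSet D) :
    refMeasure PX ν {w | (w.1.1, w.2) ∈ D} = ∫⁻ y, PX {x | (x, y) ∈ D} := by
  have hm : MeasurableSet {w : (Feat d × ℝ) × ℝ | (w.1.1, w.2) ∈ D} :=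
    (by fun_prop : Measurable fun w : (Feat d × ℝ) × ℝ => (w.1.1, w.2)) hD
  rw [refMeasure, Measure.prod_apply_symm hm]
  refine lintegral_congr fun y => ?_
  have h1 : MeasurableSet {x | (x, y) ∈ D} := measurable_prodMk_right hD
  exact (measurePreserving_fst (μ := PX) (ν := ν)).measure_preimage h1.nullMeasurableSet

lemma measurable_condDens_uncurry (hf : Measurable f) (hσ : Measurable σ) :
    Measurable fun w : Feat d × ℝ => condDens f σ w.1 w.2 := by
  unfold condDens gaussianPDFReal
  fun_prop

lemma refMeasure_superlevel (hf : Measurable f) (hσ : Measurable σ) (t : ℝ) :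
    refMeasure PX ν {w | t ≤ tripleDens f σ w} = lengthFun PX f σ t :=
  refMeasure_apply_of_pair PX ν (D := {w | t ≤ condDens f σ w.1 w.2})
    (measurableSet_le measurable_const (measurable_condDens_uncurry hf hσ))

lemma refMeasure_margin (hf : Measurable f) (hσ : Measurable σ) (lam t : ℝ) :
    refMeasure PX ν {w | |tripleDens f σ w - lam| ≤ t}
      = ∫⁻ y, PX {x | |condDens f σ x y - lam| ≤ t} := by
  have := measurable_condDens_uncurry hf hσ
  exact refMeasure_apply_of_pair PX ν (D := {w | |condDens f σ w.1 w.2 - lam| ≤ t})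
    (measurableSet_le (by fun_prop) measurable_const)

/-- Infinite total mass is what forces the oracle level to be positive. -/
lemma refMeasure_univ : refMeasure PX ν Set.univ = ∞ := by
  rw [refMeasure, ← Set.univ_prod_univ, Measure.prod_prod]
  simp

lemma refMeasure_eq_zero_of_slices {E : Set ((Feat d × ℝ) × ℝ)}
    (hE : MeasurableSet E) (h : ∀ z, volume {y | (z, y) ∈ E} = 0) : refMeasure PX ν E = 0 := by
  rw [refMeasure, Measure.prod_apply hE]
  calc _ = ∫⁻ _z, 0 ∂(PX.prod ν) := lintegral_congr fun z => h z
    _ = 0 := by simp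

lemma refMeasure_tripleDens_eq (hf : Measurable f) (hσ : Measurable σ) (hσ0 : ∀ x, 0 < σ x)
    (t : ℝ) : refMeasure PX ν {w | tripleDens f σ w = t} = 0 := by
  refine refMeasure_eq_zero_of_slices PX ν
    (measurableSet_eq_fun (measurable_tripleDens hf hσ) measurable_const) fun z => ?_
  have h := volume_gaussianPDFReal_eq (f z.1) (toNNReal_sq_ne_zero (hσ0 z.1)) t
  exact h

/-- The oracle level is positive and the oracle predictor has expected length exactly `l`. -/
lemma oracleLevel_spec (hf : Measurable f) (hσ : Measurable σ) {σ₀ : ℝ} (h0 : 0 < σ₀)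
    (hσ0 : ∀ x, σ₀ ≤ σ x) {l : ℝ} (hl : 0 < l) :
    0 < oracleLevel PX f σ l ∧
      refMeasure PX ν {w | oracleLevel PX f σ l ≤ tripleDens f σ w} = ENNReal.ofReal l := by
  have hpos : ∀ x, 0 < σ x := fun x => h0.trans_le (hσ0 x)
  have hpm := measurable_tripleDens hf hσ
  have h := genInv_superlevel (m := refMeasure PX ν) (p := tripleDens f σ) hpm
    (tripleDens_pos hpos) (tripleDens_le h0 hσ0) (integrable_tripleDens PX ν hf hσ hpos)
    (refMeasure_univ PX ν) (refMeasure_tripleDens_eq PX ν hf hσ hpos) hl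
  have e : genInv (fun t => refMeasure PX ν {w | t ≤ tripleDens f σ w}) l
      = oracleLevel PX f σ l := by
    unfold oracleLevel
    congr 1
    ext t
    exact refMeasure_superlevel PX ν hf hσ t
  rwa [e] at h

/-- The mass that the model puts outside `[-s, s]`. -/
lemma setIntegral_tail_le (hf : Measurable f) (hσ : Measurable σ) (hσ0 : ∀ x, 0 < σ x)
    {B σ₁ r : ℝ} (hfB : ∀ᵐ x ∂PX, |f x| ≤ B) (hσ1 : ∀ x, σ x ≤ σ₁) (hr : 0 ≤ r) (s : ℝ) :
    ∫ w in {w : (Feat d × ℝ) × ℝ | |w.2| ≤ s}ᶜ, tripleDens f σ w ∂(refMeasure PX ν)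
      ≤ 2 * Real.exp (B * r + σ₁ ^ 2 * r ^ 2 / 2) * Real.exp (-(r * s)) := by
  have hS : MeasurableSet {w : (Feat d × ℝ) × ℝ | |w.2| ≤ s} :=
    measurableSet_le (by fun_prop) measurable_const
  have hm := (measurable_tripleDens hf hσ).ennreal_ofReal
  rw [integral_eq_lintegral_of_nonneg_ae (ae_of_all _ fun w => (tripleDens_pos hσ0 w).le)
    (measurable_tripleDens hf hσ).aestronglyMeasurable]
  refine ENNReal.toReal_le_of_le_ofReal (by positivity) ?_
  rw [← lintegral_indicator hS.compl, lintegral_refMeasure PX ν (hm.indicator hS.compl)]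
  set c := ENNReal.ofReal (2 * Real.exp (B * r + σ₁ ^ 2 * r ^ 2 / 2) * Real.exp (-(r * s)))
  calc _ ≤ ∫⁻ _z, ∫⁻ _x, c ∂PX ∂ν := by
        refine lintegral_mono fun z => lintegral_mono_ae ?_
        filter_upwards [hfB] with x hx
        have h := lintegral_gaussian_tail_le (μ := f x) (v := (σ x ^ 2).toNNReal) (V := σ₁ ^ 2)
          (toNNReal_sq_ne_zero (hσ0 x)) hx (by
            rw [Real.coe_toNNReal _ (sq_nonneg _)]
            have := hσ0 x
            have := hσ1 x
            gcongr) hr s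
        rw [← lintegral_indicator (measurableSet_le (by fun_prop) measurable_const).compl] at h
        refine le_trans (le_of_eq ?_) h
        rfl
    _ = c := by simp

end Model

lemma isProbabilityMeasure_unif {u : ℝ} (hu : 0 < u) : IsProbabilityMeasure (unif u) :=
  cond_isProbabilityMeasure_of_finite (by simp [hu]) (by simp)

lemma ae_unif_mem {u : ℝ} : ∀ᵐ z ∂(unif u), z ∈ Set.Icc 0 u :=
  ae_cond_mem measurableSet_Icc

/-! ### The estimated density, its expected length and the empirical level. -/

section Estimator

variable {d : ℕ} {s : ℝ} {g v : Feat d → ℝ}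

/-- The randomized estimated density as a function of the triple `((x, z), y)`. -/
noncomputable def tripleEst (s : ℝ) (g v : Feat d → ℝ) (w : (Feat d × ℝ) × ℝ) : ℝ :=
  estDensRand s g v w.1.1 w.1.2 w.2

/-- The triples with `|y| ≤ s`. -/
def truncSet (d : ℕ) (s : ℝ) : Set ((Feat d × ℝ) × ℝ) := {w | |w.2| ≤ s}

lemma measurableSet_truncSet : MeasurableSet (truncSet d s) :=
  measurableSet_le (by fun_prop) measurable_const

lemma measurable_threshVar (s : ℝ) : Measurable (threshVar s) := by
  unfold threshVar
  refine (Measurable.add ?_ ?_).add ?_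
  · exact Measurable.ite (measurableSet_Icc (a := s⁻¹) (b := s)) measurable_id measurable_const
  · exact Measurable.ite (measurableSet_Iio (a := s⁻¹)) measurable_const measurable_const
  · exact Measurable.ite (measurableSet_Ioi (a := s)) measurable_const measurable_const

lemma measurable_tripleEst (hg : Measurable g) (hv : Measurable v) :
    Measurable (tripleEst s g v) := by
  have hS := measurableSet_truncSet (d := d) (s := s)
  have hth := measurable_threshVar s
  unfold tripleEst estDensRand estDens
  refine Measurable.add (Measurable.ite hS ?_ measurable_const)
    (Measurable.ite hS (by fun_prop) measurable_const)
  unfold gaussianPDFReal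
  fun_prop

lemma estDensRand_of_abs_le {x : Feat d} {z y : ℝ} (hy : |y| ≤ s) :
    estDensRand s g v x z y = gaussianPDFReal (g x) (threshVar s (v x)).toNNReal y + z := by
  simp [estDensRand, estDens, hy]

lemma estDensRand_of_lt_abs {x : Feat d} {z y : ℝ} (hy : s < |y|) :
    estDensRand s g v x z y = 0 := by
  simp [estDensRand, estDens, not_le.2 hy]

lemma estDensRand_pos (hs : 0 < s) {x : Feat d} {z y : ℝ} (hz : 0 ≤ z) (hy : |y| ≤ s) :
    0 < estDensRand s g v x z y := by
  rw [estDensRand_of_abs_le hy]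
  have := gaussianPDFReal_pos (g x) _ y (threshVar_toNNReal_ne_zero hs (v x))
  linarith

lemma abs_gridPt_le (hs : 0 < s) {M k : ℕ} (hk : k < M) : |gridPt s M k| ≤ s := by
  have hM : (0 : ℝ) < M := by exact_mod_cast (Nat.zero_le k).trans_lt hk
  have hkM : (k : ℝ) ≤ M := by exact_mod_cast hk.le
  have h1 : 2 * s * k / M ≤ 2 * s := by
    rw [div_le_iff₀ hM]
    gcongr
  have h2 : 0 ≤ 2 * s * k / M := by positivity
  rw [gridPt, abs_le]
  constructor <;> linarith

/-- The discretized length of the strict superlevel set at `(x, z)`. -/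
noncomputable def gridLength (s : ℝ) (M : ℕ) (g v : Feat d → ℝ) (t : ℝ) (z : Feat d × ℝ) : ℝ :=
  2 * s / M * ∑ k ∈ Finset.range M,
    if t < estDensRand s g v z.1 z.2 (gridPt s M k) then (1 : ℝ) else 0

lemma measurable_gridLength (hg : Measurable g) (hv : Measurable v) (M : ℕ) (t : ℝ) :
    Measurable (gridLength s M g v t) := by
  unfold gridLength
  refine (Finset.measurable_sum _ fun k _ => ?_).const_mul _
  refine Measurable.ite (measurableSet_lt measurable_const ?_) measurable_const measurable_const
  exact (measurable_tripleEst (s := s) hg hv).comp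
    (by fun_prop : Measurable fun z : Feat d × ℝ => (z, gridPt s M k))

lemma gridLength_mem (hs : 0 < s) {M : ℕ} (hM : 0 < M) (t : ℝ) (z : Feat d × ℝ) :
    gridLength s M g v t z ∈ Set.Icc 0 (2 * s) := by
  have hMR : (0 : ℝ) < M := Nat.cast_pos.2 hM
  unfold gridLength
  constructor
  · refine mul_nonneg (by positivity) (Finset.sum_nonneg fun k _ => ?_)
    split_ifs <;> norm_num
  · calc _ ≤ 2 * s / M * ∑ k ∈ Finset.range M, (1 : ℝ) := by
          gcongr with k _
          split_ifs <;> norm_num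
      _ = 2 * s := by simp; field_simp

lemma empLengthFun_eq {M N : ℕ} (xs : Fin N → Feat d) (zs : Fin N → ℝ) (t : ℝ) :
    empLengthFun s M g v xs zs t = (N : ℝ)⁻¹ * ∑ i, gridLength s M g v t (xs i, zs i) := by
  simp only [empLengthFun, gridLength]
  rw [Finset.sum_comm, ← Finset.mul_sum, ← mul_assoc]
  congr 1
  rw [div_mul_eq_div_div, div_eq_inv_mul (2 * s / M)]

lemma antitone_empLengthFun (hs : 0 < s) {M N : ℕ} (xs : Fin N → Feat d) (zs : Fin N → ℝ) :
    Antitone (empLengthFun s M g v xs zs) := by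
  intro a b hab
  unfold empLengthFun
  refine mul_le_mul_of_nonneg_left ?_ (by positivity)
  refine Finset.sum_le_sum fun k _ => Finset.sum_le_sum fun i _ => ?_
  split_ifs with h1 h2 h2
  · exact le_rfl
  · exact absurd (hab.trans_lt h1) h2
  · norm_num
  · exact le_rfl

/-- The empirical level `Ĝ⁻¹(l)`. -/
noncomputable def empLevel (s : ℝ) (M : ℕ) {N : ℕ} (g v : Feat d → ℝ) (l : ℝ)
    (ω : (Fin N → Feat d) × (Fin N → ℝ)) : ℝ :=
  genInv (fun t => ENNReal.ofReal (empLengthFun s M g v ω.1 ω.2 t)) l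

lemma exists_empLengthFun_le {M N : ℕ} {l : ℝ} (xs : Fin N → Feat d)
    (zs : Fin N → ℝ) :
    ∃ t, 0 ≤ t ∧ ENNReal.ofReal (empLengthFun s M g v xs zs t) ≤ ENNReal.ofReal l := by
  have h : ∀ᶠ t in Filter.atTop, ∀ i : Fin N, ∀ k ∈ Finset.range M,
      estDensRand s g v (xs i) (zs i) (gridPt s M k) ≤ t :=
    Filter.eventually_all.2 fun i => (Finset.eventually_all _).2 fun k _ =>
      Filter.eventually_ge_atTop _
  obtain ⟨t, ht, ht0⟩ := (h.and (Filter.eventually_ge_atTop 0)).exists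
  refine ⟨t, ht0, ?_⟩
  have : empLengthFun s M g v xs zs t = 0 := by
    unfold empLengthFun
    rw [Finset.sum_eq_zero, mul_zero]
    exact fun k hk => Finset.sum_eq_zero fun i _ => if_neg (not_lt.2 (ht i k hk))
  simp [this]

lemma empLevel_nonneg {M N : ℕ} {l : ℝ} (ω : (Fin N → Feat d) × (Fin N → ℝ)) :
    0 ≤ empLevel s M g v l ω := genInv_nonneg _ _

lemma antitone_ofReal_empLengthFun (hs : 0 < s) {M N : ℕ} (xs : Fin N → Feat d)
    (zs : Fin N → ℝ) : Antitone fun t => ENNReal.ofReal (empLengthFun s M g v xs zs t) :=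
  fun _ _ hab => ENNReal.ofReal_le_ofReal (antitone_empLengthFun hs xs zs hab)

lemma empLengthFun_le_of_empLevel_lt (hs : 0 < s) {M N : ℕ} {l : ℝ} (hl : 0 ≤ l)
    (ω : (Fin N → Feat d) × (Fin N → ℝ)) {t : ℝ} (h : empLevel s M g v l ω < t) :
    empLengthFun s M g v ω.1 ω.2 t ≤ l :=
  (ENNReal.ofReal_le_ofReal_iff hl).1
    (le_of_genInv_lt (antitone_ofReal_empLengthFun hs _ _) (exists_empLengthFun_le _ _) h)

lemma lt_empLengthFun_of_lt_empLevel {M N : ℕ} {l : ℝ}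
    (ω : (Fin N → Feat d) × (Fin N → ℝ)) {t : ℝ} (ht : 0 ≤ t) (h : t < empLevel s M g v l ω) :
    l < empLengthFun s M g v ω.1 ω.2 t :=
  (ENNReal.ofReal_lt_ofReal_iff'.1 (lt_of_lt_genInv
    (G := fun t => ENNReal.ofReal (empLengthFun s M g v ω.1 ω.2 t)) ht h)).1

lemma measurable_empLevel (hs : 0 < s) (hg : Measurable g) (hv : Measurable v) {M N : ℕ}
    {l : ℝ} : Measurable fun ω : (Fin N → Feat d) × (Fin N → ℝ) => empLevel s M g v l ω := by
  refine measurable_genInv (fun t => ?_) (fun ω => antitone_ofReal_empLengthFun hs _ _)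
    fun ω => exists_empLengthFun_le _ _
  refine Measurable.ennreal_ofReal ?_
  simp only [empLengthFun_eq]
  have := measurable_gridLength (s := s) hg hv M t
  fun_prop

/-- With nonnegative perturbations the empirical level is positive, as `l < 2s`. -/
lemma empLevel_pos (hs : 0 < s) {M N : ℕ} (hM : 0 < M) (hN : 0 < N) {l : ℝ} (hl : l < 2 * s)
    {ω : (Fin N → Feat d) × (Fin N → ℝ)} (hz : ∀ i, 0 ≤ ω.2 i) : 0 < empLevel s M g v l ω := by
  -- Only finitely many values enter, all positive; below their minimum the empirical length is the
  -- full `2 * s`, above `l`.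
  have h : ∀ᶠ t in nhdsWithin (0 : ℝ) (Set.Ioi 0), ∀ i : Fin N, ∀ k ∈ Finset.range M,
      t < estDensRand s g v (ω.1 i) (ω.2 i) (gridPt s M k) :=
    Filter.eventually_all.2 fun i => (Finset.eventually_all _).2 fun k hk =>
      mem_nhdsWithin_of_mem_nhds (gt_mem_nhds
        (estDensRand_pos hs (hz i) (abs_gridPt_le hs (Finset.mem_range.1 hk))))
  obtain ⟨b, hb, hb0⟩ := (h.and self_mem_nhdsWithin).exists
  refine lt_of_lt_of_le (show (0 : ℝ) < b from hb0)
    (le_genInv (exists_empLengthFun_le _ _) fun t _ htb => ?_)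
  have e : empLengthFun s M g v ω.1 ω.2 t = 2 * s := by
    have hMR : (0 : ℝ) < M := Nat.cast_pos.2 hM
    have hNR : (0 : ℝ) < N := Nat.cast_pos.2 hN
    unfold empLengthFun
    rw [Finset.sum_congr rfl fun k hk => Finset.sum_congr rfl fun i _ =>
      if_pos (htb.trans (hb i k hk))]
    simp
    field_simp
  rw [e]
  exact (ENNReal.ofReal_lt_ofReal_iff (by positivity)).2 hl

section Length

variable (PX : Measure (Feat d)) [IsProbabilityMeasure PX] (ν : Measure ℝ)
  [IsProbabilityMeasure ν]

lemma refMeasure_truncSet : refMeasure PX ν (truncSet d s) = ENNReal.ofReal (2 * s) := by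
  have : truncSet d s = Set.univ ×ˢ Set.Icc (-s) s := by
    ext w; simp [truncSet, abs_le]
  rw [refMeasure, this, Measure.prod_prod]
  simp [two_mul]

lemma refMeasure_truncSet_ne_top : refMeasure PX ν (truncSet d s) ≠ ∞ := by
  rw [refMeasure_truncSet]
  exact ENNReal.ofReal_ne_top

/-- The expected length `G̃(t)` of the set predictor of level `t`. -/
noncomputable def estLength (s : ℝ) (g v : Feat d → ℝ) (t : ℝ) : ℝ :=
  (refMeasure PX ν).real ({w | t ≤ tripleEst s g v w} ∩ truncSet d s)

lemma antitone_estLength : Antitone (estLength PX ν s g v) := fun _ b hab =>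
  measureReal_mono (Set.inter_subset_inter_left _ fun _ (hw : b ≤ _) => le_trans hab hw)
    (measure_ne_top_of_subset Set.inter_subset_right (refMeasure_truncSet_ne_top PX ν))

/-- For fixed `(x, z)` the perturbation only shifts the level of a Gaussian density. The restriction
to the slab is essential: the estimate vanishes identically outside it. -/
lemma refMeasure_tripleEst_eq (hs : 0 < s) (hg : Measurable g) (hv : Measurable v) (t : ℝ) :
    refMeasure PX ν ({w | tripleEst s g v w = t} ∩ truncSet d s) = 0 := by
  refine refMeasure_eq_zero_of_slices PX ν ((measurableSet_eq_fun
    (measurable_tripleEst hg hv) measurable_const).inter measurableSet_truncSet) fun z => ?_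
  refine measure_mono_null ?_ (volume_gaussianPDFReal_eq (g z.1)
    (threshVar_toNNReal_ne_zero hs (v z.1)) (t - z.2))
  rintro y ⟨h1, h2⟩
  have h1' : estDensRand s g v z.1 z.2 y = t := h1
  rw [estDensRand_of_abs_le h2] at h1'
  show gaussianPDFReal (g z.1) (threshVar s (v z.1)).toNNReal y = t - z.2
  linarith

lemma continuous_estLength (hs : 0 < s) (hg : Measurable g) (hv : Measurable v) :
    Continuous (estLength PX ν s g v) := by
  have hfin : IsFiniteMeasure ((refMeasure PX ν).restrict (truncSet d s)) :=
    ⟨by rw [Measure.restrict_apply_univ]; exact (refMeasure_truncSet_ne_top PX ν).lt_top⟩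
  have hq := measurable_tripleEst (s := s) hg hv
  have h := continuous_measureReal_superlevel ((refMeasure PX ν).restrict (truncSet d s)) hq
    fun t => by
      rw [Measure.restrict_apply (measurableSet_eq_fun hq measurable_const)]
      exact refMeasure_tripleEst_eq PX ν hs hg hv t
  refine h.congr fun t => ?_
  rw [estLength, Measure.real, Measure.real,
    Measure.restrict_apply (measurableSet_le measurable_const hq)]

/-- Together with `l < 2 * s`, this puts `l` in the range of the expected length. -/
lemma estLength_zero (hs : 0 < s) (hν : ∀ᵐ z ∂ν, 0 ≤ z) :
    estLength PX ν s g v 0 = 2 * s := by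
  have hae : ∀ᵐ w ∂(refMeasure PX ν), 0 ≤ w.1.2 :=
    Measure.quasiMeasurePreserving_fst.ae (Measure.quasiMeasurePreserving_snd.ae hν)
  have : refMeasure PX ν ({w | 0 ≤ tripleEst s g v w} ∩ truncSet d s)
      = refMeasure PX ν (truncSet d s) := by
    refine measure_congr ?_
    filter_upwards [hae] with w hw
    refine propext ⟨fun h => h.2, fun h => ⟨?_, h⟩⟩
    exact (estDensRand_pos hs hw h).le
  rw [estLength, Measure.real, this, refMeasure_truncSet, ENNReal.toReal_ofReal (by positivity)]

/-- The grid approximation of the expected length. -/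
lemma abs_integral_gridLength_sub_le (hs : 0 < s) (hg : Measurable g) (hv : Measurable v)
    {M : ℕ} (hM : 0 < M) (t : ℝ) :
    |(∫ z, gridLength s M g v t z ∂(PX.prod ν)) - estLength PX ν s g v t| ≤ 2 * s / M := by
  have hq := measurable_tripleEst (s := s) hg hv
  set I : Feat d × ℝ → Set ℝ := fun z => {y | t < estDensRand s g v z.1 z.2 y ∧ |y| ≤ s} with hI
  have hIm : MeasurableSet ({w | t < tripleEst s g v w} ∩ truncSet d s) :=
    (measurableSet_lt measurable_const hq).inter measurableSet_truncSet
  have hIs : ∀ z, I z ⊆ Set.Icc (-s) s := fun z y hy => abs_le.1 hy.2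
  have hIo : ∀ z, (I z).OrdConnected := by
    intro z
    have : I z = {y | t - z.2 < gaussianPDFReal (g z.1) (threshVar s (v z.1)).toNNReal y}
        ∩ Set.Icc (-s) s := by
      ext y
      constructor
      · rintro ⟨h1, h2⟩
        rw [estDensRand_of_abs_le h2] at h1
        exact ⟨sub_lt_iff_lt_add.2 h1, abs_le.1 h2⟩
      · rintro ⟨h1, h2⟩
        have h2' := abs_le.2 h2
        refine ⟨?_, h2'⟩
        rw [estDensRand_of_abs_le h2']
        exact sub_lt_iff_lt_add.1 h1
    rw [this]
    exact (ordConnected_lt_gaussianPDFReal _ _ _).inter Set.ordConnected_Icc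
  have hfinI : refMeasure PX ν ({w | t < tripleEst s g v w} ∩ truncSet d s) ≠ ∞ :=
    measure_ne_top_of_subset Set.inter_subset_right (refMeasure_truncSet_ne_top PX ν)
  have hslice : ∀ z, volume (I z) ≤ ENNReal.ofReal (2 * s) := fun z =>
    (measure_mono (hIs z)).trans (by rw [Real.volume_Icc]; ring_nf; rfl)
  have hmI : Measurable fun z => volume (I z) := measurable_measure_prodMk_left hIm
  have e1 : estLength PX ν s g v t = ∫ z, volume.real (I z) ∂(PX.prod ν) := by
    -- The grid counts strict superlevels while the expected length uses weak ones; they differ by a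
    -- null level set.
    have : refMeasure PX ν ({w | t ≤ tripleEst s g v w} ∩ truncSet d s)
        = refMeasure PX ν ({w | t < tripleEst s g v w} ∩ truncSet d s) := by
      refine measure_congr ?_
      have h0 := refMeasure_tripleEst_eq PX ν hs hg hv t
      filter_upwards [measure_eq_zero_iff_ae_notMem.1 h0] with w hw
      refine propext ⟨fun h => ⟨lt_of_le_of_ne h.1 fun he => hw ⟨he.symm, h.2⟩, h.2⟩,
        fun h => ⟨le_of_lt (α := ℝ) h.1, h.2⟩⟩
    rw [estLength, Measure.real, this, refMeasure, Measure.prod_apply hIm]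
    simp only [Measure.real]
    rw [integral_toReal hmI.aemeasurable
      (ae_of_all _ fun z => (hslice z).trans_lt ENNReal.ofReal_lt_top)]
    rfl
  have hi1 : Integrable (gridLength s M g v t) (PX.prod ν) :=
    (memLp_of_bounded (ae_of_all _ fun z => gridLength_mem hs hM t z)
      (measurable_gridLength hg hv M t).aestronglyMeasurable 1).integrable le_rfl
  have hi2 : Integrable (fun z => volume.real (I z)) (PX.prod ν) :=
    (memLp_of_bounded (a := 0) (b := 2 * s) (ae_of_all _ fun z => ⟨measureReal_nonneg,
      ENNReal.toReal_le_of_le_ofReal (by positivity) (hslice z)⟩)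
      hmI.ennreal_toReal.aestronglyMeasurable 1).integrable le_rfl
  rw [e1, ← integral_sub hi1 hi2]
  have hpt : ∀ z, |gridLength s M g v t z - volume.real (I z)| ≤ 2 * s / M := by
    intro z
    classical
    have h := abs_grid_sum_sub_volume_le hs hM (hIo z) (hIs z)
    have hc : gridLength s M g v t z
        = 2 * s / M * (((Finset.range M).filter fun k : ℕ => gridPt s M k ∈ I z).card : ℝ) := by
      rw [gridLength, Finset.sum_boole]
      congr 3
      refine Finset.filter_congr fun k hk => ?_
      exact ⟨fun h => ⟨h, abs_gridPt_le hs (Finset.mem_range.1 hk)⟩, fun h => h.1⟩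
    rw [hc]
    exact h
  have := norm_integral_le_of_norm_le_const (μ := PX.prod ν)
    (f := fun z => gridLength s M g v t z - volume.real (I z)) (C := 2 * s / M) (ae_of_all _ hpt)
  simpa using this

/-- The expected discrepancy between the expected length at the empirical level and `l`. -/
lemma lintegral_estLength_empLevel_sub_le (hs : 0 < s) (hg : Measurable g) (hv : Measurable v)
    {M N : ℕ} (hM : 0 < M) (hN : 0 < N) {l T : ℝ} (hl0 : 0 < l) (hl : l < 2 * s)
    (hν : ∀ᵐ z ∂ν, 0 ≤ z) (hT : 0 ≤ T) (hGT : estLength PX ν s g v T = 0) :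
    ∫⁻ ω, ENNReal.ofReal |estLength PX ν s g v (empLevel s M g v l ω) - l|
        ∂((Measure.pi fun _ : Fin N => PX).prod (Measure.pi fun _ : Fin N => ν))
      ≤ ENNReal.ofReal (2 * s / M + 4 * (s / √N)) := by
  have hNR : (0 : ℝ) < N := Nat.cast_pos.2 hN
  refine lintegral_empirical_quantile_error_le
    ((Measure.pi fun _ : Fin N => PX).prod (Measure.pi fun _ : Fin N => ν))
    (Gh := fun ω t => empLengthFun s M g v ω.1 ω.2 t) (G := estLength PX ν s g v)
    (lh := empLevel s M g v l) (κ := 2 * s / M) (V := s / √N)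
    (continuous_estLength PX ν hs hg hv) (antitone_estLength PX ν) (fun _ => measureReal_nonneg) hT hGT
    hl0.le (by rw [estLength_zero PX ν hs hν]; exact hl.le) (measurable_empLevel hs hg hv)
    empLevel_nonneg (fun ω t _ h => empLengthFun_le_of_empLevel_lt hs hl0.le ω h)
    (fun ω t ht h => lt_empLengthFun_of_lt_empLevel ω ht h) (by positivity) (by positivity)
    fun t δ hδ => ?_
  -- Grid lengths lie in `[0, 2 * s]`, so their variance is at most `s ^ 2`; this is the source of
  -- `V = s / √N`, while `κ` absorbs the grid bias.
  have h := meas_empirical_mean_deviation_le PX ν hN (measurable_gridLength (s := s) hg hv M t)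
    (gridLength_mem hs hM t) hδ
  refine (measure_mono fun ω hω => ?_).trans (h.trans (le_of_eq ?_))
  · have hω' : 2 * s / M + δ ≤ |empLengthFun s M g v ω.1 ω.2 t - estLength PX ν s g v t| := hω
    show δ ≤ |(N : ℝ)⁻¹ * (∑ i, gridLength s M g v t (ω.1 i, ω.2 i))
      - ∫ z, gridLength s M g v t z ∂(PX.prod ν)|
    rw [← empLengthFun_eq]
    have h1 := abs_integral_gridLength_sub_le PX ν hs hg hv hM t
    have h2 := abs_sub_le (empLengthFun s M g v ω.1 ω.2 t)
      (∫ z, gridLength s M g v t z ∂(PX.prod ν)) (estLength PX ν s g v t)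
    linarith
  · rw [div_pow s, Real.sq_sqrt hNR.le]
    congr 3
    ring

end Length

end Estimator

/-- The estimated density is uniformly close to the conditional density on the truncated triples,
up to the perturbation. -/
lemma ae_abs_tripleEst_sub_le {d : ℕ} {PX : Measure (Feat d)} {f σ : Feat d → ℝ} {u : ℝ} (hu : 0 < u) {K : Set (Feat d)}
    (hK : ∀ᵐ x ∂PX, x ∈ K) {s : ℝ} {g v : Feat d → ℝ} {Δ : ℝ} (hΔ0 : 0 ≤ Δ)
    (hΔ : supError K f σ s g v ≤ ENNReal.ofReal Δ) :
    ∀ᵐ w ∂(refMeasure PX (unif u)), w ∈ truncSet d s →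
      |tripleEst s g v w - tripleDens f σ w| ≤ Δ + u := by
  have := isProbabilityMeasure_unif hu
  have h1 : ∀ᵐ w ∂(refMeasure PX (unif u)), w.1.1 ∈ K :=
    Measure.quasiMeasurePreserving_fst.ae (Measure.quasiMeasurePreserving_fst.ae hK)
  have h2 : ∀ᵐ w ∂(refMeasure PX (unif u)), w.1.2 ∈ Set.Icc 0 u :=
    Measure.quasiMeasurePreserving_fst.ae (Measure.quasiMeasurePreserving_snd.ae ae_unif_mem)
  filter_upwards [h1, h2] with w hw1 hw2 hwS
  have hwS' : |w.2| ≤ s := hwS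
  have h3 : ENNReal.ofReal |estDens s g v w.1.1 w.2 - condDens f σ w.1.1 w.2|
      ≤ ENNReal.ofReal Δ := by
    refine le_trans ?_ hΔ
    exact le_iSup₂_of_le w.1.1 hw1 (le_iSup₂_of_le w.2 (abs_le.1 hwS') le_rfl)
  have h4 := (ENNReal.ofReal_le_ofReal_iff hΔ0).1 h3
  have h5 : tripleEst s g v w - tripleDens f σ w
      = (estDens s g v w.1.1 w.2 - condDens f σ w.1.1 w.2) + w.1.2 := by
    simp only [tripleEst, tripleDens, estDensRand, if_pos hwS']
    ring
  rw [h5]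
  refine (abs_add_le _ _).trans (add_le_add h4 ?_)
  rw [abs_of_nonneg hw2.1]
  exact hw2.2

/-! ### Excess risk for a fixed sample, then averaged over the unlabeled sample. -/

section Excess

variable {d : ℕ} {PX : Measure (Feat d)} [IsProbabilityMeasure PX] {f σ : Feat d → ℝ}

/-- The risk of a predictor with finite expected length, as a real number. -/
lemma risk_eq_ofReal (ν : Measure ℝ) [IsProbabilityMeasure ν] (hf : Measurable f)
    (hσ : Measurable σ) (hσ0 : ∀ x, 0 < σ x) {l : ℝ}
    (hlam : 0 ≤ oracleLevel PX f σ l) {Γ : Feat d → ℝ → Set ℝ} {A : Set ((Feat d × ℝ) × ℝ)}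
    (hA : MeasurableSet A) (hAΓ : ∀ x z y, ((x, z), y) ∈ A ↔ y ∈ Γ x z)
    (hfin : refMeasure PX ν A ≠ ∞) :
    risk PX f σ l ν Γ = ENNReal.ofReal
      (1 - ∫ w in A, (tripleDens f σ w - oracleLevel PX f σ l) ∂(refMeasure PX ν)) := by
  have hp := integrable_tripleDens PX ν hf hσ hσ0
  have hp0 : ∀ w, 0 ≤ tripleDens f σ w := fun w => (tripleDens_pos hσ0 w).le
  rw [risk_eq PX ν hf hσ hσ0 l hA hAΓ,
    ← ofReal_integral_eq_lintegral_ofReal hp.integrableOn (ae_of_all _ hp0),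
    ← ofReal_measureReal hfin, ← ENNReal.ofReal_mul hlam,
    ← ENNReal.ofReal_add (integral_nonneg hp0) (mul_nonneg hlam measureReal_nonneg)]
  congr 1
  have h1 := integral_add_compl hA hp
  rw [integral_tripleDens PX ν hf hσ hσ0] at h1
  rw [integral_sub hp.integrableOn (integrableOn_const hfin)]
  simp only [integral_const, smul_eq_mul, measureReal_restrict_apply_univ]
  linarith

/-- Excess risk of the plug-in predictor with empirical level, for a fixed sample of positive
empirical level. -/
lemma excessRisk_empPredictor_le (ν : Measure ℝ) [IsProbabilityMeasure ν] (hf : Measurable f)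
    (hσ : Measurable σ) {σ₀ : ℝ} (h0 : 0 < σ₀) (hσ0 : ∀ x, σ₀ ≤ σ x) {c₀ t₀ α l : ℝ}
    (hc₀ : 0 < c₀) (ht₀ : 0 < t₀) (hα : 0 ≤ α) (hl : 0 < l)
    (hmargin : MarginCondition PX f σ (oracleLevel PX f σ l) c₀ t₀ α)
    {s : ℝ} (hs : 0 < s) (hls : l < 2 * s) (hν : ∀ᵐ z ∂ν, 0 ≤ z)
    {g v : Feat d → ℝ} (hg : Measurable g) (hv : Measurable v) {ε : ℝ} (hε : 0 < ε)
    (hclose : ∀ᵐ w ∂(refMeasure PX ν), w ∈ truncSet d s →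
      |tripleEst s g v w - tripleDens f σ w| ≤ ε)
    {T : ℝ} (hT : 0 ≤ T) (hGT : estLength PX ν s g v T = 0)
    {M N : ℕ} {ω : (Fin N → Feat d) × (Fin N → ℝ)} (hpos : 0 < empLevel s M g v l ω) :
    excessRisk PX f σ l ν (empPredictor s M g v ω.1 ω.2 l)
      ≤ ENNReal.ofReal ((2 * c₀ + (1 / t₀) ^ (1 + α)) * ε ^ (1 + α)
          + 2 * ∫ w in (truncSet d s)ᶜ, tripleDens f σ w ∂(refMeasure PX ν)
          + (√(2 * Real.pi * σ₀ ^ 2))⁻¹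
            * |estLength PX ν s g v (empLevel s M g v l ω) - l|) := by
  have hσp : ∀ x, 0 < σ x := fun x => h0.trans_le (hσ0 x)
  obtain ⟨hlam, hlamA⟩ := oracleLevel_spec PX ν hf hσ h0 hσ0 hl
  set lam := oracleLevel PX f σ l with hlamdef
  set m := refMeasure PX ν with hm
  set S := truncSet d s with hSdef
  set P := (√(2 * Real.pi * σ₀ ^ 2))⁻¹ with hPdef
  set p := tripleDens f σ with hpdef
  set q := tripleEst s g v with hqdef
  have hpm : Measurable p := measurable_tripleDens hf hσ
  have hqm : Measurable q := measurable_tripleEst hg hv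
  have hS : MeasurableSet S := measurableSet_truncSet
  have hp : Integrable p m := integrable_tripleDens PX ν hf hσ hσp
  have hp0 : ∀ w, 0 ≤ p w := fun w => (tripleDens_pos hσp w).le
  have hpP : ∀ w, p w ≤ P := tripleDens_le h0 hσ0
  have hfS : m S ≠ ∞ := refMeasure_truncSet_ne_top PX ν
  have hfA : m {w | lam ≤ p w} ≠ ∞ := by rw [hlamA]; exact ENNReal.ofReal_ne_top
  -- A level above the supremum of `p` would make the oracle set empty, contradicting its measure `l
  -- > 0`.
  have hlamP : lam ≤ P := by
    by_contra hc
    have : {w | lam ≤ p w} = ∅ := Set.eq_empty_of_forall_notMem fun w hw =>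
      hc (le_trans (show lam ≤ p w from hw) (hpP w))
    rw [this, measure_empty] at hlamA
    exact absurd hlamA.symm (ENNReal.ofReal_pos.2 hl).ne'
  -- the level whose predictor has expected length exactly `l`
  obtain ⟨kap, hkap, hkapl⟩ := intermediate_value_Icc' hT
    (continuous_estLength PX ν hs hg hv).continuousOn
    (show l ∈ Set.Icc (estLength PX ν s g v T) (estLength PX ν s g v 0) from
      ⟨hGT ▸ hl.le, by rw [estLength_zero PX ν hs hν]; exact hls.le⟩)
  have hfB : m ({w | kap ≤ q w} ∩ S) ≠ ∞ := measure_ne_top_of_subset Set.inter_subset_right hfS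
  have heq : m ({w | kap ≤ q w} ∩ S) = m {w | lam ≤ p w} := by
    rw [hlamA, ← hkapl, estLength, ofReal_measureReal hfB]
  have hJ1 : (∫ w in {w | lam ≤ p w}, (p w - lam) ∂m)
      - ∫ w in {w | kap ≤ q w} ∩ S, (p w - lam) ∂m
      ≤ (2 * c₀ + (1 / t₀) ^ (1 + α)) * ε ^ (1 + α) + 2 * ∫ w in Sᶜ, p w ∂m := by
    have htail : 0 ≤ ∫ w in Sᶜ, p w ∂m := integral_nonneg hp0
    have hεα : 0 < ε ^ (1 + α) := Real.rpow_pos_of_pos hε _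
    have htα : 0 < (1 / t₀) ^ (1 + α) := Real.rpow_pos_of_pos (by positivity) _
    rcases le_or_gt ε t₀ with h | h
    · have h1 := plugin_threshold_le hpm hqm hS hp hp0 hlam.le hkap.1 hε.le
        (c := c₀ * ε ^ α) (by positivity) hfA heq hclose
        (by rw [hm, refMeasure_margin PX ν hf hσ]; exact hmargin ε hε h)
      have h2 : 2 * ε * (c₀ * ε ^ α) = 2 * c₀ * ε ^ (1 + α) := by
        rw [Real.rpow_add hε, Real.rpow_one]; ring
      nlinarith
    -- Beyond `t₀` the margin condition is silent, but the loss is at most `∫ p = 1 ≤ (ε / t₀) ^ (1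
    -- + α)`.
    · have h1 := plugin_threshold_le_integral (A := {w | lam ≤ p w})
        (B := {w | kap ≤ q w} ∩ S) (measurableSet_le measurable_const hpm)
        ((measurableSet_le measurable_const hqm).inter hS) hp hp0 lam hfA heq
      rw [integral_tripleDens PX ν hf hσ hσp] at h1
      have h2 : 1 ≤ (1 / t₀) ^ (1 + α) * ε ^ (1 + α) := by
        rw [← Real.mul_rpow (by positivity) hε.le]
        refine Real.one_le_rpow ?_ (by linarith)
        rw [one_div, ← div_eq_inv_mul, one_le_div ht₀]
        exact h.le
      nlinarith
  have hJ2 := threshold_level_change_le hqm hS hp hp0 hlam.le hlamP hpP hfS kap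
    (empLevel s M g v l ω)
  have hEl : ∀ t, m.real ({w | t ≤ q w} ∩ S) = estLength PX ν s g v t := fun t => rfl
  rw [hEl, hEl, hkapl] at hJ2
  have hr1 : risk PX f σ l ν (fun x _ => oraclePredictor PX f σ l x)
      = ENNReal.ofReal (1 - ∫ w in {w | lam ≤ p w}, (p w - lam) ∂m) :=
    risk_eq_ofReal ν hf hσ hσp hlam.le (measurableSet_le measurable_const hpm)
      (fun _ _ _ => Iff.rfl) hfA
  have hr2 : risk PX f σ l ν (empPredictor s M g v ω.1 ω.2 l)
      = ENNReal.ofReal (1 - ∫ w in {w | empLevel s M g v l ω ≤ q w} ∩ S, (p w - lam) ∂m) := by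
    refine risk_eq_ofReal ν hf hσ hσp hlam.le ((measurableSet_le measurable_const hqm).inter hS)
      (fun x z y => ⟨fun h => h.1, fun h => ⟨h, ?_⟩⟩)
      (measure_ne_top_of_subset Set.inter_subset_right hfS)
    -- Outside the slab the estimate is zero, below the positive empirical level, so the predictor
    -- has no points there.
    by_contra hc
    have h1 : estDensRand s g v x z y = 0 := estDensRand_of_lt_abs (not_le.1 hc)
    have h2 : empLevel s M g v l ω ≤ estDensRand s g v x z y := h
    linarith
  unfold excessRisk
  rw [hr1, hr2, tsub_le_iff_left]
  refine le_trans (ENNReal.ofReal_le_ofReal ?_) ENNReal.ofReal_add_le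
  linarith

/-- Expected excess risk over the unlabeled sample, for fixed estimators. -/
lemma lintegral_excessRisk_le (hf : Measurable f)
    (hσ : Measurable σ) {σ₀ σ₁ B : ℝ} (h0 : 0 < σ₀) (hσ0 : ∀ x, σ₀ ≤ σ x) (hσ1 : ∀ x, σ x ≤ σ₁)
    {K : Set (Feat d)} (hK : ∀ᵐ x ∂PX, x ∈ K) (hB : ∀ x ∈ K, |f x| ≤ B) {c₀ t₀ α l : ℝ}
    (hc₀ : 0 < c₀) (ht₀ : 0 < t₀) (hα : 0 ≤ α) (hl : 0 < l)
    (hmargin : MarginCondition PX f σ (oracleLevel PX f σ l) c₀ t₀ α)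
    {s u : ℝ} (hs : 0 < s) (hls : l < 2 * s) (hu : 0 < u)
    {g v : Feat d → ℝ} (hg : Measurable g) (hv : Measurable v) {Δ : ℝ} (hΔ0 : 0 ≤ Δ)
    (hΔ : supError K f σ s g v ≤ ENNReal.ofReal Δ) {M N : ℕ} (hM : 0 < M) (hN : 0 < N) :
    ∫⁻ ω, excessRisk PX f σ l (unif u) (empPredictor s M g v ω.1 ω.2 l)
        ∂((Measure.pi fun _ : Fin N => PX).prod (Measure.pi fun _ : Fin N => unif u))
      ≤ ENNReal.ofReal ((2 * c₀ + (1 / t₀) ^ (1 + α)) * (Δ + u) ^ (1 + α)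
          + 2 * (2 * Real.exp (B * (1 + α) + σ₁ ^ 2 * (1 + α) ^ 2 / 2)
              * Real.exp (-((1 + α) * s)))
          + (√(2 * Real.pi * σ₀ ^ 2))⁻¹ * (2 * s / M + 4 * (s / √N))) := by
  have := isProbabilityMeasure_unif hu
  have hσp : ∀ x, 0 < σ x := fun x => h0.trans_le (hσ0 x)
  set P := (√(2 * Real.pi * σ₀ ^ 2))⁻¹ with hP
  have hP0 : 0 ≤ P := by positivity
  have hε : 0 < Δ + u := by linarith
  have hν : ∀ᵐ z ∂(unif u), 0 ≤ z := ae_unif_mem.mono fun z hz => hz.1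
  have hclose := ae_abs_tripleEst_sub_le (PX := PX) (f := f) (σ := σ) hu hK hΔ0 hΔ
  -- A level exceeding the estimate almost everywhere on the slab, since `p ≤ P` and the estimate is
  -- within `Δ + u` of `p`.
  set T := P + (Δ + u) + 1 with hTdef
  have hT : 0 ≤ T := by positivity
  have hGT : estLength PX (unif u) s g v T = 0 := by
    rw [estLength, Measure.real, ENNReal.toReal_eq_zero_iff]
    left
    refine measure_eq_zero_iff_ae_notMem.2 ?_
    filter_upwards [hclose] with w hw hwm
    have h1 := (abs_le.1 (hw hwm.2)).2
    have h2 : T ≤ tripleEst s g v w := hwm.1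
    have h3 := tripleDens_le (f := f) h0 hσ0 w
    linarith
  have htail := setIntegral_tail_le PX (unif u) hf hσ hσp (hK.mono hB) hσ1
    (by linarith : 0 ≤ 1 + α) s
  set τ := ∫ w in (truncSet d s)ᶜ, tripleDens f σ w ∂(refMeasure PX (unif u)) with hτ
  have hτ0 : 0 ≤ τ := integral_nonneg fun w => (tripleDens_pos hσp w).le
  set a := (2 * c₀ + (1 / t₀) ^ (1 + α)) * (Δ + u) ^ (1 + α) with ha
  have ha0 : 0 ≤ a := by positivity
  have hzs : ∀ᵐ ω ∂((Measure.pi fun _ : Fin N => PX).prod (Measure.pi fun _ : Fin N => unif u)),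
      ∀ i, 0 ≤ ω.2 i :=
    Measure.quasiMeasurePreserving_snd.ae
      (ae_all_iff.2 fun i => 
      (measurePreserving_eval (fun _ : Fin N => unif u) i).quasiMeasurePreserving.ae hν)
  have hmain := lintegral_estLength_empLevel_sub_le PX (unif u) hs hg hv hM hN hl hls hν hT hGT
  calc _ ≤ ∫⁻ ω, (ENNReal.ofReal (a + 2 * τ) + ENNReal.ofReal P *
          ENNReal.ofReal |estLength PX (unif u) s g v (empLevel s M g v l ω) - l|)
          ∂((Measure.pi fun _ : Fin N => PX).prod (Measure.pi fun _ : Fin N => unif u)) := by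
        refine lintegral_mono_ae ?_
        filter_upwards [hzs] with ω hω
        have h := excessRisk_empPredictor_le (unif u) hf hσ h0 hσ0 hc₀ ht₀ hα hl hmargin hs hls hν
          hg hv hε hclose hT hGT (empLevel_pos (g := g) (v := v) hs hM hN hls hω)
        refine h.trans (le_of_eq ?_)
        rw [← ENNReal.ofReal_mul hP0, ← ENNReal.ofReal_add (by positivity) (by positivity)]
    _ ≤ ENNReal.ofReal (a + 2 * τ)
          + ENNReal.ofReal P * ENNReal.ofReal (2 * s / M + 4 * (s / √N)) := by
        rw [lintegral_add_left measurable_const, lintegral_const_mul' _ _ ENNReal.ofReal_ne_top]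
        simp only [lintegral_const, measure_univ, mul_one]
        gcongr
    _ ≤ _ := by
        rw [← ENNReal.ofReal_mul hP0, ← ENNReal.ofReal_add (by positivity) (by positivity)]
        refine ENNReal.ofReal_le_ofReal ?_
        have : τ ≤ 2 * Real.exp (B * (1 + α) + σ₁ ^ 2 * (1 + α) ^ 2 / 2)
              * Real.exp (-((1 + α) * s)) := htail
        linarith

end Excess

lemma isProbabilityMeasure_labeledLaw {d : ℕ} (PX : Measure (Feat d)) [IsProbabilityMeasure PX]
    {f σ : Feat d → ℝ} (hf : Measurable f) (hσ : Measurable σ) (n : ℕ) :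
    IsProbabilityMeasure (labeledLaw PX f σ n) := by
  have : IsProbabilityMeasure (jointLaw PX f σ) :=
    Measure.isProbabilityMeasure_map (by fun_prop)
  unfold labeledLaw
  infer_instance

lemma add_rpow_one_add_le {a b α : ℝ} (ha : 0 ≤ a) (hb : 0 ≤ b) (hα : 0 ≤ α) :
    (a + b) ^ (1 + α) ≤ 2 ^ α * (a ^ (1 + α) + b ^ (1 + α)) := by
  lift a to NNReal using ha
  lift b to NNReal using hb
  have h := NNReal.rpow_add_le_mul_rpow_add_rpow a b (p := 1 + α) (by linarith)
  rw [add_sub_cancel_left] at h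
  exact_mod_cast h

/-- Absorption of all error terms into a single constant. -/
lemma error_terms_le {a P E Δ u α s N M k : ℝ} (ha : 0 ≤ a) (hP : 0 ≤ P) (hE : 0 ≤ E)
    (hΔ : 0 ≤ Δ) (hu : 0 ≤ u) (hα : 0 ≤ α) (hs : 0 < s) (hN : 0 < N) (hM : 4 * √N < M)
    (hk : 0 < k) (hsk : s = Real.log k) (hsN : s ≤ Real.log N) :
    a * (Δ + u) ^ (1 + α) + 2 * (2 * E * Real.exp (-((1 + α) * s)))
        + P * (2 * s / M + 4 * (s / √N))
      ≤ (a * 2 ^ α + 4 * E + 5 * P + 1) * (Δ ^ (1 + α)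
        + (1 / k ^ (1 + α) + u ^ (1 + α) + Real.log N / √N)) := by
  have hsN0 : 0 < √N := Real.sqrt_pos.2 hN
  have h1 := mul_le_mul_of_nonneg_left (add_rpow_one_add_le hΔ hu hα) ha
  have h2 : Real.exp (-((1 + α) * s)) = 1 / k ^ (1 + α) := by
    rw [Real.exp_neg, hsk, one_div, mul_comm, Real.rpow_def_of_pos hk]
  -- `M > 4 √N` brings the grid bias below `s / √N`, and `s ≤ log N`.
  have h3 : 2 * s / M + 4 * (s / √N) ≤ 5 * (Real.log N / √N) := by
    have e1 : 2 * s / M ≤ 2 * s / (4 * √N) := by gcongr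
    have e2 : 2 * s / (4 * √N) ≤ s / √N := by
      rw [div_le_div_iff₀ (by positivity) hsN0]
      nlinarith [mul_pos hs hsN0]
    have e3 : s / √N ≤ Real.log N / √N := by gcongr
    linarith
  have h4 := mul_le_mul_of_nonneg_left h3 hP
  rw [h2]
  have p1 : 0 ≤ Δ ^ (1 + α) := by positivity
  have p2 : 0 ≤ u ^ (1 + α) := by positivity
  have p3 : 0 ≤ 1 / k ^ (1 + α) := by positivity
  have p4 : 0 ≤ Real.log N / √N := by
    have : 0 ≤ Real.log N := hs.le.trans hsN
    positivity
  set A := a * 2 ^ α with hA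
  have hA0 : 0 ≤ A := by positivity
  set x := Δ ^ (1 + α)
  set y := u ^ (1 + α)
  set z := 1 / k ^ (1 + α)
  set t := Real.log N / √N
  have h1' : a * (Δ + u) ^ (1 + α) ≤ A * (x + y) := by rw [hA, mul_assoc]; exact h1
  have : A * (x + y) + 4 * E * z + P * (5 * t) ≤ (A + 4 * E + 5 * P + 1) * (x + (z + y + t)) := by
    have q1 : 0 ≤ A * (z + t) := by positivity
    have q2 : 0 ≤ E * (x + y + t) := by positivity
    have q3 : 0 ≤ P * (x + y + z) := by positivity
    nlinarith
  linarith

end LengthPI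

/-! ### The main bound. -/

theorem proposition5 {d : ℕ} (f σ : LengthPI.Feat d → ℝ)
    (hσ : LengthPI.BoundedSigma σ)
    (hf_lip : ∃ L, LipschitzWith L f)
    (hσ_lip : ∃ L, LipschitzWith L (fun x => σ x ^ 2))
    (K : Set (LengthPI.Feat d))
    (c₀ t₀ α : ℝ) (hc₀ : 0 < c₀) (ht₀ : 0 < t₀) (hα : 0 ≤ α) :
    ∃ C : ℝ, 0 < C ∧
      ∀ (PX : Measure (LengthPI.Feat d)) [IsProbabilityMeasure PX],
        LengthPI.StrongDensity PX K →
      ∀ l : ℝ, 0 < l →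
        LengthPI.MarginCondition PX f σ (LengthPI.oracleLevel PX f σ l) c₀ t₀ α →
      ∀ (n N M : ℕ) (u s : ℝ), 0 < u →
        s = Real.log (min (n : ℝ) (N : ℝ)) → l < 2 * s → 4 * Real.sqrt N < M →
      -- the estimators of the regression function and of the variance function
      ∀ fhat vtil : (Fin n → LengthPI.Feat d × ℝ) → LengthPI.Feat d → ℝ,
        Measurable (Function.uncurry fhat) → Measurable (Function.uncurry vtil) →
        ∫⁻ ω, LengthPI.excessRisk PX f σ l (LengthPI.unif u)
              (LengthPI.empPredictor s M (fhat ω.1) (vtil ω.1) ω.2.1 ω.2.2 l)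
            ∂(LengthPI.sampleLaw PX f σ n N u)
          ≤ ENNReal.ofReal C *
            ((∫⁻ D, (LengthPI.supError K f σ s (fhat D) (vtil D)) ^ (1 + α)
                ∂(LengthPI.labeledLaw PX f σ n))
              + ENNReal.ofReal (1 / (min (n : ℝ) (N : ℝ)) ^ (1 + α) + u ^ (1 + α)
                  + Real.log N / Real.sqrt N)) := by
  -- The constant is fixed before `PX`, and it needs a bound for `f` on `K`; when `K` is not
  -- compact, no `PX` satisfies the density assumption.
  by_cases hKc : IsCompact K
  swap
  · exact ⟨1, one_pos, fun PX _ hSD => absurd hSD.1 hKc⟩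
  obtain ⟨Lf, hLf⟩ := hf_lip
  obtain ⟨Lσ, hLσ⟩ := hσ_lip
  obtain ⟨σ₀, σ₁, h0, -, hσb⟩ := hσ
  have hσ0 : ∀ x, σ₀ ≤ σ x := fun x => (hσb x).1
  have hf : Measurable f := hLf.continuous.measurable
  have hσm : Measurable σ := by
    have h1 : σ = fun x => √(σ x ^ 2) :=
      funext fun x => (Real.sqrt_sq (h0.le.trans (hσ0 x))).symm
    rw [h1]
    exact hLσ.continuous.measurable.sqrt
  obtain ⟨B, hB⟩ := hKc.exists_bound_of_continuousOn hLf.continuous.continuousOn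
  set a := 2 * c₀ + (1 / t₀) ^ (1 + α) with ha
  set P := (√(2 * Real.pi * σ₀ ^ 2))⁻¹ with hP
  set E := Real.exp (B * (1 + α) + σ₁ ^ 2 * (1 + α) ^ 2 / 2) with hE
  have ha0 : 0 ≤ a := by positivity
  have hP0 : 0 ≤ P := by positivity
  have hE0 : 0 ≤ E := by positivity
  set C := a * 2 ^ α + 4 * E + 5 * P + 1 with hC
  have hC0 : 0 < C := by positivity
  refine ⟨C, hC0, ?_⟩
  intro PX _ hSD l hl hmargin n N M u s hu hs hls hM fhat vtil hfm hvm
  have hK : ∀ᵐ x ∂PX, x ∈ K := hSD.2.2.1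
  -- From `0 < l < 2 * s`. As `Real.log 0 = 0`, this also rules out `n = 0` and `N = 0`.
  have hspos : 0 < s := by linarith
  have hk0 : (0 : ℝ) ≤ min (n : ℝ) (N : ℝ) := by positivity
  have hk : 0 < min (n : ℝ) (N : ℝ) := by
    refine lt_of_le_of_ne hk0 fun h => ?_
    rw [← h, Real.log_zero] at hs
    linarith
  have hNR : (0 : ℝ) < N := hk.trans_le (min_le_right _ _)
  have hN : 0 < N := Nat.cast_pos.1 hNR
  have hM0 : 0 < M := by
    have : (0 : ℝ) < M := lt_of_le_of_lt (by positivity) hM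
    exact Nat.cast_pos.1 this
  have hsN : s ≤ Real.log N := hs ▸ Real.log_le_log hk (min_le_right _ _)
  have hprob := LengthPI.isProbabilityMeasure_labeledLaw PX hf hσm n
  set r := 1 / (min (n : ℝ) (N : ℝ)) ^ (1 + α) + u ^ (1 + α) + Real.log N / √N with hr
  have hr0 : 0 ≤ r := by
    have : 0 ≤ Real.log N := hspos.le.trans hsN
    positivity
  have hα1 : 0 < 1 + α := by linarith
  have key : ∀ D, ∫⁻ ω, LengthPI.excessRisk PX f σ l (LengthPI.unif u)
        (LengthPI.empPredictor s M (fhat D) (vtil D) ω.1 ω.2 l)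
        ∂((Measure.pi fun _ : Fin N => PX).prod (Measure.pi fun _ : Fin N => LengthPI.unif u))
      ≤ ENNReal.ofReal C * ((LengthPI.supError K f σ s (fhat D) (vtil D)) ^ (1 + α)
          + ENNReal.ofReal r) := by
    intro D
    -- An infinite sup-error makes the right-hand side infinite; otherwise it serves as the real
    -- number `Δ`.
    by_cases htop : LengthPI.supError K f σ s (fhat D) (vtil D) = ∞
    · rw [htop, ENNReal.top_rpow_of_pos hα1, top_add,
        ENNReal.mul_top (ENNReal.ofReal_pos.2 hC0).ne']
      exact le_top
    · have h := LengthPI.lintegral_excessRisk_le hf hσm h0 hσ0 (fun x => (hσb x).2) hK hB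
        hc₀ ht₀ hα hl hmargin hspos hls hu (g := fhat D) (v := vtil D)
        hfm.of_uncurry_left hvm.of_uncurry_left ENNReal.toReal_nonneg
        (ENNReal.ofReal_toReal htop).ge hM0 hN
      refine h.trans ((ENNReal.ofReal_le_ofReal (LengthPI.error_terms_le ha0 hP0 hE0
        ENNReal.toReal_nonneg hu.le hα hspos hNR hM hk hs hsN)).trans (le_of_eq ?_))
      rw [ENNReal.ofReal_mul hC0.le, ENNReal.ofReal_add (by positivity) hr0,
        ← ENNReal.ofReal_rpow_of_nonneg ENNReal.toReal_nonneg hα1.le,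
        ENNReal.ofReal_toReal htop]
  unfold LengthPI.sampleLaw
  -- This half of Tonelli needs no measurability, so neither the excess risk nor the sup-error has
  -- to be shown measurable in the sample.
  refine (lintegral_prod_le _).trans ((lintegral_mono key).trans (le_of_eq ?_))
  rw [lintegral_const_mul' _ _ ENNReal.ofReal_ne_top, lintegral_add_right _ measurable_const]
  simp only [lintegral_const, measure_univ, mul_one]
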